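/- **Setting.** For an integer $k\ge 0$ let $\mathcal M_k$ be the space of modular forms of weight $k$ for some congruence subgroup $\Gamma(N)$, $N\ge 1$ (holomorphic on the upper half-plane and at all cusps), and let $\mathcal M=\bigoplus_{k\ge0}\mathcal M_k$, a graded commutative $\mathbb C$-algebra containing the constants. The group $G^+(\mathbb Q)=\mathrm{GL}^+(2,\mathbb Q)$ acts on the right of $\mathcal M$ by $f|\gamma\,(z)=\det(\gamma)^{k/2}f\!\left(\frac{az+b}{cz+d}\right)(cz+d)^{-k}$ for $f\in\mathcal M_k$, $\gamma=\begin{pmatrix}a&b\\c&d\end{pmatrix}$. Let $\mathcal A=\mathcal A_{G^+(\mathbb Q)}=\mathcal M\rtimes G^+(\mathbb Q)$ be the crossed product: finite sums $\sum f\,U_\gamma^*$ ($f\in\mathcal M$, $\gamma\in G^+(\mathbb Q)$) with product $fU_\alpha^*\cdot gU_\beta^*=f\,(g|\alpha)\,U_{\beta\alpha}^*$; $\mathcal M$ is the subalgebra of elements $fU_1^*$, and $[b,a]=ba-ab$. Let $\mathcal H_1$ be the Hopf algebra which, as an algebra, is the enveloping algebra over $\mathbb C$ of the Lie algebra with basis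 $X,Y,\delta_n$ ($n\ge1$) and brackets $[Y,X]=X$, $[Y,\delta_n]=n\delta_n$, $[X,\delta_n]=\delta_{n+1}$, $[\delta_k,\delta_l]=0$, with coproduct determined by $\Delta Y=Y\otimes1+1\otimes Y$, $\Delta X=X\otimes 1+1\otimes X+\delta_1\otimes Y$, $\Delta\delta_1=\delta_1\otimes1+1\otimes\delta_1$. On $\mathcal M$ put $Y(f)=\frac k2 f$ and $X(f)=\frac1{2\pi i}f'-\frac1{2\pi i}\left(\frac{d}{dz}\log\eta^4\right)Y(f)$ for $f\in\mathcal M_k$, where $\eta$ is the Dedekind eta function, so that $X(\mathcal M_k)\subset\mathcal M_{k+2}$. For $\gamma\in G^+(\mathbb Q)$ let $\mu_\gamma=\frac1{2\pi i}\frac{d}{dz}\log\frac{\eta^4|_2\gamma}{\eta^4}\in\mathcal M_2$. Then $\mathcal H_1$ acts on $\mathcal A$ by $X(fU_\gamma^*)=X(f)U_\gamma^*$, $Y(fU_\gamma^*)=Y(f)U_\gamma^*$, $\delta_n(fU_\gamma^*)=X^{n-1}(\mu_\gamma)\,f\,U_\gamma^*$. Put $\delta_2'=\delta_2-\frac12\delta_1^2$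 and $\omega_4=-\frac{1}{72}E_4\in\mathcal M_4$, where $E_4=1+240\sum_{n\ge1}n^3\frac{q^n}{1-q^n}$, $q=e^{2\pi iz}$. Let $\mathcal L(\mathcal H_1,\mathcal A)$ be the algebra of linear maps $\mathcal H_1\to\mathcal A$ under convolution $(uv)(h)=\sum u(h_{(1)})v(h_{(2)})$. A 1-cocycle is an invertible element $u$ of $\mathcal L(\mathcal H_1,\mathcal A)$ with $u(hh')=\sum u(h_{(1)})\,h_{(2)}(u(h'))$ for all $h,h'\in\mathcal H_1$. The conjugate under $u$ of the action is $\tilde h(a)=\sum u(h_{(1)})\,h_{(2)}(a)\,u^{-1}(h_{(3)})$. **Proposition.** Let $t\in\mathcal M_2$, $\lambda\in\mathbb C$, $m\in\mathcal M_2$. 1. There is a unique 1-cocycle $u\in\mathcal L(\mathcal H_1,\mathcal A)$ with $u(X)=t$, $u(Y)=\lambda$, $u(\delta_1)=m$. 2. The conjugate under this $u$ of the action of $\mathcal H_1$ is given on generators, for all $a\in\mathcal A$, by $$\tilde Y(a)=Y(a),\qquad \tilde X(a)=X(a)+[t-\lambda m,a]-\lambda\,\delta_1(a)+m\,Y(a),\qquad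 \tilde\delta_1(a)=\delta_1(a)+[m,a].$$ 3. The conjugate under $u$ of $\delta_2'$ is $$\tilde\delta_2'(a)=\left[X(m)+\tfrac{m^2}{2}-\omega_4,\;a\right]\qquad(a\in\mathcal A),$$ and $\tilde\delta_2'\ne0$ for every choice of $t$, $\lambda$, $m$. Moreover the equation $X(m)+\frac{m^2}{2}=\omega_4$ has no solution $m\in\mathcal M_2$. -/

import Mathlib

noncomputable section

namespace ModularHecke

open UpperHalfPlane Derivative
open scoped MatrixGroups ModularForm Manifold CongruenceSubgroup

/-- The inclusion of `GL⁺(2, ℚ)` in `GL(2, ℝ)`. -/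
def toReal : GL(2, ℚ)⁺ →* GL (Fin 2) ℝ :=
  (Matrix.GeneralLinearGroup.map (Rat.castHom ℝ)).comp (Matrix.GLPos (Fin 2) ℚ).subtype

lemma toReal_det_pos (γ : GL(2, ℚ)⁺) : 0 < (toReal γ).val.det := by
  have h := γ.2
  rw [Matrix.mem_glpos] at h
  have : (toReal γ).val.det = ((γ : GL (Fin 2) ℚ).val.det : ℝ) := by
    simp [toReal, Matrix.det_fin_two]
  rw [this]
  exact_mod_cast h

/-- The slash operator
`(f|_k γ)(z) = det(γ)^{k/2} f(γ z) (c z + d)^{-k}`. -/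
def slash (k : ℕ) (γ : GL(2, ℚ)⁺) (f : ℍ → ℂ) : ℍ → ℂ := fun z ↦
  (((toReal γ).val.det ^ ((k : ℝ) / 2) : ℝ) : ℂ) * f (toReal γ • z) * (denom (toReal γ) z ^ k)⁻¹

lemma slash_eq (k : ℕ) (γ : GL(2, ℚ)⁺) (f : ℍ → ℂ) :
    slash k γ f = (((toReal γ).val.det ^ (1 - (k : ℝ) / 2) : ℝ) : ℂ) • (f ∣[(k : ℤ)] toReal γ) := by
  have hd := toReal_det_pos γ
  ext z
  have h1 : (toReal γ).val.det ^ ((k : ℝ) / 2) =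
      (toReal γ).val.det ^ (1 - (k : ℝ) / 2) * (toReal γ).val.det ^ ((k : ℤ) - 1) := by
    rw [← Real.rpow_intCast, ← Real.rpow_add hd]
    congr 1
    push_cast
    ring
  have hσ (x) : σ (toReal γ) x = x := by
    simp only [σ, Matrix.GeneralLinearGroup.val_det_apply, hd, if_true]
    rfl
  simp only [slash, h1, Pi.smul_apply, smul_eq_mul, ModularForm.slash_apply, hσ,
    Matrix.GeneralLinearGroup.val_det_apply, abs_of_pos hd, zpow_neg, zpow_natCast]
  push_cast
  ring

/-- The space `M_k` of modular forms of weight `k` and of arbitrary level: the union over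
`N ≥ 1` of the spaces of modular forms of weight `k` for `Γ(N)`. -/
def IsModular (k : ℕ) (f : ℍ → ℂ) : Prop :=
  ∃ N : ℕ, N ≠ 0 ∧ ∃ g : ModularForm (Γ(N) : Subgroup (GL (Fin 2) ℝ)) k, ⇑g = f

lemma isModular_iff (k : ℕ) (f : ℍ → ℂ) : IsModular k f ↔
    MDiff f ∧ (∃ N : ℕ, N ≠ 0 ∧ ∀ γ ∈ Γ(N), f ∣[(k : ℤ)] γ = f) ∧
      ∀ γ : SL(2, ℤ), IsBoundedAtImInfty (f ∣[(k : ℤ)] γ) := by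
  constructor
  · rintro ⟨N, hN, g, rfl⟩
    have : NeZero N := ⟨hN⟩
    refine ⟨ModularFormClass.holo g, ⟨N, hN, fun γ hγ ↦ ?_⟩, fun γ ↦ ?_⟩
    · exact SlashInvariantFormClass.slash_action_eq g _ ⟨γ, hγ, rfl⟩
    · exact ModularFormClass.bdd_at_infty_slash g γ
  · rintro ⟨hd, ⟨N, hN, hinv⟩, hb⟩
    have : NeZero N := ⟨hN⟩
    refine ⟨N, hN, ⟨⟨f, ?_⟩, hd, ?_⟩, rfl⟩
    · rintro _ ⟨γ, hγ, rfl⟩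
      exact hinv γ hγ
    · intro c hc
      rw [Subgroup.IsArithmetic.isCusp_iff_isCusp_SL2Z] at hc
      rw [OnePoint.isBoundedAt_iff_forall_SL2Z hc]
      exact fun γ _ ↦ hb γ

lemma Gamma_mono {N N' : ℕ} (h : N ∣ N') : Γ(N') ≤ Γ(N) := by
  intro γ hγ
  rw [CongruenceSubgroup.Gamma_mem] at hγ ⊢
  have key (a b : ℤ) (hab : (a : ZMod N') = b) : (a : ZMod N) = b := by
    rw [ZMod.intCast_eq_intCast_iff_dvd_sub] at hab ⊢
    exact (Int.natCast_dvd_natCast.mpr h).trans hab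
  exact ⟨by simpa using key _ 1 (by simpa using hγ.1), by simpa using key _ 0 (by simpa using hγ.2.1),
    by simpa using key _ 0 (by simpa using hγ.2.2.1), by simpa using key _ 1 (by simpa using hγ.2.2.2)⟩

lemma IsModular.add {k : ℕ} {f g : ℍ → ℂ} (hf : IsModular k f) (hg : IsModular k g) :
    IsModular k (f + g) := by
  rw [isModular_iff] at *
  obtain ⟨h1, ⟨N, hN, h2⟩, h3⟩ := hf
  obtain ⟨h1', ⟨N', hN', h2'⟩, h3'⟩ := hg
  refine ⟨h1.add h1', ⟨N * N', mul_ne_zero hN hN', fun γ hγ ↦ ?_⟩, fun γ ↦ ?_⟩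
  · rw [SlashAction.add_slash, h2 γ (Gamma_mono (dvd_mul_right _ _) hγ),
      h2' γ (Gamma_mono (dvd_mul_left _ _) hγ)]
  · rw [SlashAction.add_slash]
    exact (h3 γ).add (h3' γ)

lemma IsModular.mul {k l : ℕ} {f g : ℍ → ℂ} (hf : IsModular k f) (hg : IsModular l g) :
    IsModular (k + l) (f * g) := by
  rw [isModular_iff] at *
  obtain ⟨h1, ⟨N, hN, h2⟩, h3⟩ := hf
  obtain ⟨h1', ⟨N', hN', h2'⟩, h3'⟩ := hg
  push_cast
  refine ⟨h1.mul h1', ⟨N * N', mul_ne_zero hN hN', fun γ hγ ↦ ?_⟩, fun γ ↦ ?_⟩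
  · rw [ModularForm.mul_slash_SL2, h2 γ (Gamma_mono (dvd_mul_right _ _) hγ),
      h2' γ (Gamma_mono (dvd_mul_left _ _) hγ)]
  · rw [ModularForm.mul_slash_SL2]
    exact (h3 γ).mul (h3' γ)

lemma isModular_const (c : ℂ) : IsModular 0 (fun _ ↦ c) :=
  ⟨1, one_ne_zero, ModularForm.const c, rfl⟩

lemma IsModular.smul {k : ℕ} {f : ℍ → ℂ} (c : ℂ) (hf : IsModular k f) :
    IsModular k (c • f) := by
  have := (isModular_const c).mul hf
  rw [zero_add] at this
  exact this

/-- Modular forms of weight `k` and arbitrary level, as a complex vector space. -/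
def M (k : ℕ) : Submodule ℂ (ℍ → ℂ) where
  carrier := {f | IsModular k f}
  add_mem' := IsModular.add
  zero_mem' := ⟨1, one_ne_zero, 0, rfl⟩
  smul_mem' c _ hf := hf.smul c

open scoped Pointwise in
lemma IsModular.slash {k : ℕ} {f : ℍ → ℂ} (hf : IsModular k f) (γ : GL(2, ℚ)⁺) :
    IsModular k (slash k γ f) := by
  rw [slash_eq]
  refine IsModular.smul _ ?_
  obtain ⟨N, hN, g, rfl⟩ := hf
  have : NeZero N := ⟨hN⟩
  have hArith : (ConjAct.toConjAct (toReal γ)⁻¹ • (Γ(N) : Subgroup (GL (Fin 2) ℝ))).IsArithmetic := by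
    have := Subgroup.IsArithmetic.conj (Γ(N) : Subgroup (GL (Fin 2) ℝ)) (γ : GL (Fin 2) ℚ)⁻¹
    rwa [map_inv] at this
  obtain ⟨N', hN', h⟩ := CongruenceSubgroup.exists_Gamma_le_conj' (γ : GL (Fin 2) ℚ) N
  rw [isModular_iff]
  refine ⟨(ModularFormClass.holo g).slash _ _, ⟨N', hN', fun α hα ↦ ?_⟩, fun α ↦ ?_⟩
  · refine SlashInvariantFormClass.slash_action_eq (ModularForm.translate g (toReal γ)) _ ?_
    rw [map_inv, Subgroup.mem_inv_pointwise_smul_iff]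
    exact h (Subgroup.smul_mem_pointwise_smul _ _ _ ⟨α, hα, rfl⟩)
  · exact ModularFormClass.bdd_at_infty_slash (ModularForm.translate g (toReal γ)) α

/-! The connection `X` and the cocycle `μ`. -/

/-- The fourth power of the Dedekind eta function. -/
def etaFour : ℍ → ℂ := fun z ↦ ModularForm.eta z ^ 4

/-- The logarithmic derivative `(2πi)⁻¹ d/dz log F`. -/
def dlog (F : ℍ → ℂ) : ℍ → ℂ := fun z ↦ normalizedDerivOfComplex F z / F z

lemma etaFour_ne_zero (z : ℍ) : etaFour z ≠ 0 := pow_ne_zero _ (ModularForm.eta_ne_zero z.2)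

lemma hasDerivAt_etaFour (z : ℍ) : HasDerivAt (etaFour ∘ ofComplex)
    (4 * ModularForm.eta z ^ 3 * deriv ModularForm.eta z) z := by
  have h := ((ModularForm.differentiableAt_eta_of_mem_upperHalfPlaneSet z.2).hasDerivAt).pow 4
  refine (h.congr_of_eventuallyEq ?_).congr_deriv (by norm_num)
  filter_upwards [isOpen_upperHalfPlaneSet.mem_nhds z.2] with w hw
  simp [etaFour, ofComplex_apply_of_im_pos hw]

lemma mdiff_etaFour : MDiff etaFour := fun z ↦
  UpperHalfPlane.mdifferentiableAt_iff.mpr (hasDerivAt_etaFour z).differentiableAt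

lemma dlog_etaFour : dlog etaFour = (6⁻¹ : ℂ) • EisensteinSeries.E2 := by
  ext z
  have h0 := ModularForm.eta_ne_zero z.2
  have h := ModularForm.logDeriv_eta_eq_E2 z
  rw [logDeriv_apply, div_eq_iff h0] at h
  simp only [dlog, normalizedDerivOfComplex, (hasDerivAt_etaFour z).deriv, h, etaFour,
    Pi.smul_apply, smul_eq_mul]
  have hπ : (Real.pi : ℂ) ≠ 0 := by exact_mod_cast Real.pi_ne_zero
  have hI := Complex.I_ne_zero
  field_simp
  ring

/-- The operator `X = (2πi)⁻¹ d/dz - (2πi)⁻¹ (d/dz log η⁴) Y` in weight `k`, where `Y = k/2`. -/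
def ramanujan (k : ℕ) (f : ℍ → ℂ) : ℍ → ℂ := fun z ↦
  normalizedDerivOfComplex f z - dlog etaFour z * ((k : ℂ) / 2 * f z)

lemma ramanujan_eq (k : ℕ) (f : ℍ → ℂ) : ramanujan k f = serreDerivative (k : ℤ) f := by
  ext z
  simp only [ramanujan, dlog_etaFour, serreDerivative_apply, Pi.smul_apply, smul_eq_mul]
  push_cast
  ring

lemma isBounded_deriv {f : ℍ → ℂ} (hf : MDiff f) (hb : IsBoundedAtImInfty f) :
    IsBoundedAtImInfty (normalizedDerivOfComplex f) := by
  rw [isBoundedAtImInfty_iff] at hb ⊢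
  obtain ⟨C, A, h⟩ := hb
  refine ⟨‖(2 * Real.pi * Complex.I : ℂ)⁻¹‖ * (C / 1), max A 0 + 2, fun z hz ↦ ?_⟩
  have him (w : ℂ) (hw : w ∈ Metric.closedBall (z : ℂ) 1) : max A 0 + 1 ≤ w.im := by
    have h1 : |(w - z).im| ≤ 1 := (Complex.abs_im_le_norm _).trans (by
      simpa [dist_eq_norm] using hw)
    rw [Complex.sub_im, abs_le] at h1
    have : z.im = (z : ℂ).im := rfl
    linarith [h1.1]
  have hpos (w : ℂ) (hw : w ∈ Metric.closedBall (z : ℂ) 1) : 0 < w.im := by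
    linarith [him w hw, le_max_right A 0]
  rw [UpperHalfPlane.mdifferentiable_iff] at hf
  rw [normalizedDerivOfComplex, norm_mul]
  refine mul_le_mul_of_nonneg_left ?_ (norm_nonneg _)
  refine Complex.norm_deriv_le_of_forall_mem_sphere_norm_le one_pos ?_ fun w hw ↦ ?_
  · refine DifferentiableOn.diffContOnCl ?_
    rw [closure_ball _ one_ne_zero]
    exact hf.mono fun w hw ↦ hpos w hw
  · have hw' := Metric.sphere_subset_closedBall hw
    rw [Function.comp_apply, ofComplex_apply_of_im_pos (hpos w hw')]
    refine h _ ?_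
    change A ≤ w.im
    linarith [him w hw', le_max_left A 0]

lemma IsModular.ramanujan {k : ℕ} {f : ℍ → ℂ} (hf : IsModular k f) :
    IsModular (k + 2) (ramanujan k f) := by
  rw [ramanujan_eq]
  rw [isModular_iff] at *
  obtain ⟨h1, ⟨N, hN, h2⟩, h3⟩ := hf
  push_cast
  refine ⟨serreDerivative_mdifferentiable _ h1, ⟨N, hN, fun γ hγ ↦ ?_⟩, fun γ ↦ ?_⟩
  · exact_mod_cast serreDerivative_slash_invariant (k := k) h1 (h2 γ hγ)
  · have := serreDerivative_slash_equivariant (k := k) (γ := γ) h1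
    push_cast at this
    rw [this]
    have hb := h3 γ
    have hd : MDiff (f ∣[(k : ℤ)] γ) := h1.slash _ _
    exact (isBounded_deriv hd hb).sub
      (((Filter.const_boundedAtFilter _ ((k : ℂ) * 12⁻¹)).mul
        EisensteinSeries.isBoundedAtImInfty_E2).mul hb)

/-- The correction to the weight two slash action for logarithmic derivatives. -/
lemma dlog_slash {F : ℍ → ℂ} (hF : MDiff F) (hF0 : ∀ z, F z ≠ 0) {g : GL (Fin 2) ℝ}
    (hg : 0 < g.val.det) : dlog (F ∣[(2 : ℤ)] g) = dlog F ∣[(2 : ℤ)] g -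
      fun z : ℍ ↦ 2 * (2 * Real.pi * Complex.I : ℂ)⁻¹ * (g 1 0 / denom g z) := by
  ext z
  have hσ (x) : σ g x = x := by
    simp only [σ, Matrix.GeneralLinearGroup.val_det_apply, hg, if_true]
    rfl
  have hd : ((g.val.det : ℝ) : ℂ) ≠ 0 := by exact_mod_cast hg.ne'
  have hz := denom_ne_zero g z
  have h0 := hF0 (g • z)
  simp only [dlog, normalizedDerivOfComplex_slash hF hg, Pi.sub_apply, ModularForm.slash_apply, hσ,
    Matrix.GeneralLinearGroup.val_det_apply, abs_of_pos hg]
  have e1 : (((g.val.det : ℝ) : ℂ)) ^ ((2 : ℤ) + 2 - 1) = ((g.val.det : ℝ) : ℂ) ^ 3 := by norm_cast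
  have e2 : (((g.val.det : ℝ) : ℂ)) ^ ((2 : ℤ) - 1) = ((g.val.det : ℝ) : ℂ) := by norm_num
  have e3 : denom g z ^ (-((2 : ℤ) + 2)) = (denom g z ^ 4)⁻¹ := by rw [zpow_neg]; norm_cast
  have e4 : denom g z ^ (-(2 : ℤ)) = (denom g z ^ 2)⁻¹ := by rw [zpow_neg]; norm_cast
  rw [e1, e2, e3, e4]
  field_simp
  push_cast
  ring

lemma slash_ne_zero {F : ℍ → ℂ} (hF0 : ∀ z, F z ≠ 0) {g : GL (Fin 2) ℝ}
    (hg : 0 < g.val.det) (z : ℍ) : (F ∣[(2 : ℤ)] g) z ≠ 0 := by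
  have hd : ((|g.val.det| : ℝ) : ℂ) ≠ 0 := by exact_mod_cast (abs_pos.mpr hg.ne').ne'
  simp only [ModularForm.slash_apply, Matrix.GeneralLinearGroup.val_det_apply]
  refine mul_ne_zero (mul_ne_zero ?_ (zpow_ne_zero _ hd)) (zpow_ne_zero _ (denom_ne_zero g z))
  simpa using hF0 _

lemma SL_det (α : SL(2, ℤ)) : 0 < (α : GL (Fin 2) ℝ).val.det := by
  rw [← Matrix.GeneralLinearGroup.val_det_apply]; simp

lemma SL_eq_map (α : SL(2, ℤ)) : (α : GL (Fin 2) ℝ) =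
    Matrix.GeneralLinearGroup.map (Rat.castHom ℝ) (Matrix.SpecialLinearGroup.mapGL ℚ α) := by
  ext i j
  simp

lemma dlog_etaFour_SL (α : SL(2, ℤ)) :
    dlog (etaFour ∣[(2 : ℤ)] (α : GL (Fin 2) ℝ)) = dlog etaFour := by
  rw [dlog_slash mdiff_etaFour etaFour_ne_zero (SL_det α), dlog_etaFour, ← ModularForm.SL_slash,
    ModularForm.SL_smul_slash, EisensteinSeries.E2_slash_action]
  ext z
  have hπ : (Real.pi : ℂ) ≠ 0 := by exact_mod_cast Real.pi_ne_zero
  have hI := Complex.I_ne_zero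
  have hz := denom_ne_zero (α : GL (Fin 2) ℝ) z
  simp only [Pi.sub_apply, Pi.smul_apply, smul_eq_mul, EisensteinSeries.D2, riemannZeta_two]
  have : (((α : GL (Fin 2) ℝ) 1 0 : ℝ) : ℂ) = ((α 1 0 : ℤ) : ℂ) := by simp
  rw [this]
  field_simp
  ring_nf
  simp

lemma dlog_etaFour_SL_mul (α : SL(2, ℤ)) {g : GL (Fin 2) ℝ} (hg : 0 < g.val.det) :
    dlog (etaFour ∣[(2 : ℤ)] ((α : GL (Fin 2) ℝ) * g)) = dlog (etaFour ∣[(2 : ℤ)] g) := by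
  rw [SlashAction.slash_mul, dlog_slash (mdiff_etaFour.slash _ _)
    (slash_ne_zero etaFour_ne_zero (SL_det α)) hg, dlog_etaFour_SL,
    dlog_slash mdiff_etaFour etaFour_ne_zero hg]

lemma dlog_etaFour_mul_SL {g : GL (Fin 2) ℝ} (hg : 0 < g.val.det) (α : SL(2, ℤ)) :
    (dlog (etaFour ∣[(2 : ℤ)] g) - dlog etaFour) ∣[(2 : ℤ)] α =
      dlog (etaFour ∣[(2 : ℤ)] (g * (α : GL (Fin 2) ℝ))) - dlog etaFour := by
  have h1 := dlog_slash (mdiff_etaFour.slash 2 g) (slash_ne_zero etaFour_ne_zero hg) (SL_det α)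
  have h2 := dlog_slash mdiff_etaFour etaFour_ne_zero (SL_det α)
  rw [dlog_etaFour_SL] at h2
  rw [SlashAction.slash_mul, h1, sub_eq_add_neg, SlashAction.add_slash, SlashAction.neg_slash]
  rw [eq_sub_iff_add_eq] at h2
  rw [ModularForm.SL_slash, ModularForm.SL_slash, ← h2]
  abel

lemma isBounded_dlog (γ : GL(2, ℚ)⁺) (α : SL(2, ℤ)) :
    IsBoundedAtImInfty (dlog (etaFour ∣[(2 : ℤ)] (toReal γ * (α : GL (Fin 2) ℝ)))) := by
  set g := toReal γ * (α : GL (Fin 2) ℝ) with hgdef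
  have hg : 0 < g.val.det := by
    rw [hgdef, Units.val_mul, Matrix.det_mul]
    exact mul_pos (toReal_det_pos γ) (SL_det α)
  obtain ⟨α', h⟩ := OnePoint.exists_mem_SL2 ℤ
    (((γ : GL (Fin 2) ℚ) * Matrix.SpecialLinearGroup.mapGL ℚ α) • (OnePoint.infty : OnePoint ℚ))
  rw [eq_comm, ← inv_smul_eq_iff, ← mul_smul, ← map_inv, OnePoint.smul_infty_eq_self_iff] at h
  rw [← dlog_etaFour_SL_mul α'⁻¹ hg]
  obtain ⟨b, hbdef⟩ : ∃ b, b = ((α'⁻¹ : SL(2, ℤ)) : GL (Fin 2) ℝ) * g := ⟨_, rfl⟩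
  rw [← hbdef]
  have hb : 0 < b.val.det := by
    rw [hbdef, Units.val_mul, Matrix.det_mul]
    exact mul_pos (SL_det _) hg
  have h' : b 1 0 = 0 := by
    have : b = Matrix.GeneralLinearGroup.map (Rat.castHom ℝ)
        (Matrix.SpecialLinearGroup.mapGL ℚ α'⁻¹ *
          ((γ : GL (Fin 2) ℚ) * Matrix.SpecialLinearGroup.mapGL ℚ α)) := by
      rw [map_mul, map_mul, ← SL_eq_map, ← SL_eq_map, hbdef, hgdef]
      rfl
    rw [this, Matrix.GeneralLinearGroup.map_apply, h, map_zero]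
  rw [dlog_slash mdiff_etaFour etaFour_ne_zero hb, dlog_etaFour]
  have h0 : (fun z : ℍ ↦ 2 * (2 * Real.pi * Complex.I : ℂ)⁻¹ * (b 1 0 / denom b z)) = 0 := by
    ext z
    simp [h']
  rw [h0, sub_zero]
  refine IsBoundedAtImInfty.slash _ h' ?_
  exact (Filter.const_boundedAtFilter _ (6⁻¹ : ℂ)).mul EisensteinSeries.isBoundedAtImInfty_E2

/-- `μ_γ = (2πi)⁻¹ d/dz log (η⁴|γ / η⁴)`, as a function on the upper half-plane. -/
def muFun (γ : GL(2, ℚ)⁺) : ℍ → ℂ := dlog (slash 2 γ etaFour / etaFour)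

lemma muFun_eq (γ : GL(2, ℚ)⁺) :
    muFun γ = dlog (etaFour ∣[(2 : ℤ)] toReal γ) - dlog etaFour := by
  have hs : slash 2 γ etaFour = etaFour ∣[(2 : ℤ)] toReal γ := by
    rw [slash_eq]; norm_num
  have hd : MDiff (etaFour ∣[(2 : ℤ)] toReal γ) := mdiff_etaFour.slash _ _
  have h0 := slash_ne_zero etaFour_ne_zero (toReal_det_pos γ)
  ext z
  rw [muFun, hs]
  have e := UpperHalfPlane.mdifferentiableAt_iff.mp (hd z)
  have e' := UpperHalfPlane.mdifferentiableAt_iff.mp (mdiff_etaFour z)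
  have := deriv_div e e' (by simpa using etaFour_ne_zero z)
  have key : (etaFour ∣[(2 : ℤ)] toReal γ / etaFour) ∘ ofComplex =
    ((etaFour ∣[(2 : ℤ)] toReal γ) ∘ ofComplex) / (etaFour ∘ ofComplex) := rfl
  simp only [dlog, normalizedDerivOfComplex, key, this, Pi.div_apply, Pi.sub_apply,
    Function.comp_apply, ofComplex_apply]
  have := h0 z
  have := etaFour_ne_zero z
  field_simp

lemma isModular_muFun (γ : GL(2, ℚ)⁺) : IsModular 2 (muFun γ) := by
  have hg := toReal_det_pos γ
  rw [isModular_iff, muFun_eq]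
  push_cast
  refine ⟨?_, ?_, fun α ↦ ?_⟩
  · rw [dlog_slash mdiff_etaFour etaFour_ne_zero hg, dlog_etaFour]
    have hE : MDiff ((6⁻¹ : ℂ) • EisensteinSeries.E2) := by
      exact MDifferentiable.mul mdifferentiable_const E2_mdifferentiable
    refine ((hE.slash _ _).sub ?_).sub hE
    refine MDifferentiable.mul mdifferentiable_const ?_
    have := mdifferentiable_denom_zpow (toReal γ) (-1)
    simp only [div_eq_mul_inv]
    refine MDifferentiable.mul mdifferentiable_const ?_
    simpa using this
  · obtain ⟨N, hN, h⟩ := CongruenceSubgroup.exists_Gamma_le_conj (γ : GL (Fin 2) ℚ) 1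
    refine ⟨N, hN, fun α hα ↦ ?_⟩
    obtain ⟨α', -, hα'⟩ := h α hα
    have : toReal γ * (α : GL (Fin 2) ℝ) = (α' : GL (Fin 2) ℝ) * toReal γ := by
      rw [SL_eq_map, SL_eq_map, hα', toReal, MonoidHom.comp_apply, ← map_mul, ← map_mul]
      simp
    rw [dlog_etaFour_mul_SL hg, this, dlog_etaFour_SL_mul _ hg]
  · rw [dlog_etaFour_mul_SL hg]
    refine (isBounded_dlog γ α).sub ?_
    rw [dlog_etaFour]
    exact (Filter.const_boundedAtFilter _ (6⁻¹ : ℂ)).mul EisensteinSeries.isBoundedAtImInfty_E2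

/-! The algebra of modular forms of all levels and the crossed product. -/

instance : SetLike.GradedMonoid M where
  one_mem := isModular_const 1
  mul_mem _ _ _ _ hf hg := IsModular.mul hf hg

/-- The graded algebra `𝓜 = ⨁ₖ 𝓜ₖ` of modular forms of all levels. -/
def ModForms : Type := DirectSum ℕ fun k ↦ M k

instance : CommRing ModForms := inferInstanceAs (CommRing (DirectSum ℕ fun k ↦ M k))

instance : Algebra ℂ ModForms := inferInstanceAs (Algebra ℂ (DirectSum ℕ fun k ↦ M k))

/-- The inclusion of `𝓜ₖ` in `𝓜`. -/
def incl (k : ℕ) : M k →ₗ[ℂ] ModForms where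
  toFun := DirectSum.of (fun k ↦ M k) k
  map_add' := map_add (DirectSum.of (fun k ↦ M k) k)
  map_smul' := map_smul (DirectSum.lof ℂ ℕ (fun k ↦ M k) k)

/-- The linear map out of `𝓜` with given restrictions to the `𝓜ₖ`. -/
def liftM {N : Type} [AddCommGroup N] [Module ℂ N] (φ : ∀ k, M k →ₗ[ℂ] N) :
    ModForms →ₗ[ℂ] N where
  toFun := DirectSum.toModule ℂ ℕ N φ
  map_add' := map_add (DirectSum.toModule ℂ ℕ N φ)
  map_smul' := map_smul (DirectSum.toModule ℂ ℕ N φ)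

@[simp] lemma liftM_incl {N : Type} [AddCommGroup N] [Module ℂ N] (φ : ∀ k, M k →ₗ[ℂ] N)
    (k : ℕ) (f : M k) : liftM φ (incl k f) = φ k f :=
  DirectSum.toModule_lof ..

lemma slash_smul (k : ℕ) (γ : GL(2, ℚ)⁺) (c : ℂ) (f : ℍ → ℂ) :
    slash k γ (c • f) = c • slash k γ f := by
  ext z; simp [slash]; ring

lemma slash_add (k : ℕ) (γ : GL(2, ℚ)⁺) (f g : ℍ → ℂ) :
    slash k γ (f + g) = slash k γ f + slash k γ g := by
  ext z; simp [slash]; ring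

lemma slash_one (k : ℕ) (f : ℍ → ℂ) : slash k 1 f = f := by
  rw [slash_eq]; simp

lemma slash_mul (k : ℕ) (γ γ' : GL(2, ℚ)⁺) (f : ℍ → ℂ) :
    slash k (γ * γ') f = slash k γ' (slash k γ f) := by
  simp only [slash_eq k γ, slash_smul]
  simp only [slash_eq, map_mul, SlashAction.slash_mul, smul_smul, Units.val_mul, Matrix.det_mul,
    Real.mul_rpow (toReal_det_pos γ).le (toReal_det_pos γ').le, Complex.ofReal_mul]

lemma slash_mul_fun (k l : ℕ) (γ : GL(2, ℚ)⁺) (f g : ℍ → ℂ) :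
    slash (k + l) γ (f * g) = slash k γ f * slash l γ g := by
  ext z
  have : (toReal γ).val.det ^ (((k + l : ℕ) : ℝ) / 2) =
      (toReal γ).val.det ^ ((k : ℝ) / 2) * (toReal γ).val.det ^ ((l : ℝ) / 2) := by
    rw [← Real.rpow_add (toReal_det_pos γ)]; push_cast; ring_nf
  simp only [slash, Pi.mul_apply, this, pow_add, mul_inv]
  push_cast
  ring

/-- The slash operator as a linear endomorphism of `𝓜ₖ`. -/
def slashLin (k : ℕ) (γ : GL(2, ℚ)⁺) : M k →ₗ[ℂ] M k where
  toFun f := ⟨slash k γ f, IsModular.slash f.2 γ⟩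
  map_add' f g := Subtype.ext (slash_add k γ f g)
  map_smul' c f := Subtype.ext (slash_smul k γ c f)

/-- The slash operator on `𝓜`, relative to the weight on each homogeneous component. -/
def slashM (γ : GL(2, ℚ)⁺) : ModForms →ₗ[ℂ] ModForms := liftM fun k ↦ incl k ∘ₗ slashLin k γ

@[simp] lemma slashM_incl (γ : GL(2, ℚ)⁺) (k : ℕ) (f : M k) :
    slashM γ (incl k f) = incl k (slashLin k γ f) := liftM_incl ..

lemma incl_mul (k l : ℕ) (f : M k) (g : M l) :
    incl k f * incl l g = incl (k + l) ⟨f * g, IsModular.mul f.2 g.2⟩ := DirectSum.of_mul_of _ _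

/-- A linear map out of `𝓜` is determined by its values on homogeneous elements. -/
lemma modForms_induction {p : ModForms → Prop} (a : ModForms) (h0 : p 0)
    (h1 : ∀ k (f : M k), p (incl k f)) (h2 : ∀ a b, p a → p b → p (a + b)) : p a :=
  DirectSum.induction_on a h0 h1 h2

lemma slashM_one (γ : GL(2, ℚ)⁺) : slashM γ 1 = 1 := by
  have : (1 : ModForms) = incl 0 ⟨1, isModular_const 1⟩ := rfl
  rw [this, slashM_incl]
  congr 1
  ext z
  simp [slashLin, slash]

lemma slashM_mul (γ : GL(2, ℚ)⁺) (a b : ModForms) : slashM γ (a * b) = slashM γ a * slashM γ b := by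
  induction a using modForms_induction with
  | h0 => simp
  | h2 a a' h h' => rw [add_mul, map_add, h, h', map_add, add_mul]
  | h1 k f =>
    induction b using modForms_induction with
    | h0 => simp
    | h2 b b' h h' => rw [mul_add, map_add, h, h', map_add, mul_add]
    | h1 l g =>
      rw [incl_mul, slashM_incl, slashM_incl, slashM_incl, incl_mul]
      congr 1
      exact Subtype.ext (slash_mul_fun k l γ f g)

/-- The right action `f ↦ f|γ` of `GL⁺(2, ℚ)` on `𝓜`, as a left action of the opposite group. -/
instance : MulSemiringAction (GL(2, ℚ)⁺)ᵐᵒᵖ ModForms where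
  smul γ a := slashM γ.unop a
  one_smul a := by
    change slashM 1 a = a
    induction a using modForms_induction with
    | h0 => simp
    | h2 a a' h h' => rw [map_add, h, h']
    | h1 k f => rw [slashM_incl]; congr 1; exact Subtype.ext (slash_one k f)
  mul_smul γ γ' a := by
    change slashM (γ'.unop * γ.unop) a = slashM γ.unop (slashM γ'.unop a)
    induction a using modForms_induction with
    | h0 => simp
    | h2 a a' h h' => simp only [map_add, h, h']
    | h1 k f => simp only [slashM_incl]; congr 1; exact Subtype.ext (slash_mul k _ _ f)
  smul_zero γ := map_zero (slashM γ.unop)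
  smul_add γ := map_add (slashM γ.unop)
  smul_one γ := slashM_one γ.unop
  smul_mul γ := slashM_mul γ.unop

lemma op_smul_def (γ : GL(2, ℚ)⁺) (a : ModForms) : MulOpposite.op γ • a = slashM γ a := rfl

instance : SMulCommClass (GL(2, ℚ)⁺)ᵐᵒᵖ ℂ ModForms where
  smul_comm γ c a := map_smul (slashM γ.unop) c a

/-- The crossed product `𝓜 ⋊ GL⁺(2, ℚ)`. -/
def Crossed : Type := SkewMonoidAlgebra ModForms (GL(2, ℚ)⁺)ᵐᵒᵖ

instance : Ring Crossed := inferInstanceAs (Ring (SkewMonoidAlgebra ModForms (GL(2, ℚ)⁺)ᵐᵒᵖ))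

instance : Algebra ℂ Crossed :=
  inferInstanceAs (Algebra ℂ (SkewMonoidAlgebra ModForms (GL(2, ℚ)⁺)ᵐᵒᵖ))

/-- The element `f U_γ^*` of the crossed product. -/
def U (γ : GL(2, ℚ)⁺) : ModForms →ₗ[ℂ] Crossed where
  toFun f := SkewMonoidAlgebra.single (MulOpposite.op γ) f
  map_add' := SkewMonoidAlgebra.single_add _
  map_smul' c f := (SkewMonoidAlgebra.smul_single c (MulOpposite.op γ) f).symm

/-- The product rule of the crossed product. -/
lemma U_mul_U (α β : GL(2, ℚ)⁺) (f g : ModForms) :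
    U α f * U β g = U (β * α) (f * slashM α g) :=
  SkewMonoidAlgebra.single_mul_single (a₁ := MulOpposite.op α) (a₂ := MulOpposite.op β)
    (b₁ := f) (b₂ := g)

/-- The linear map out of the crossed product with prescribed values `φ_γ(f)` on `f U_γ^*`. -/
def liftU {N : Type} [AddCommGroup N] [Module ℂ N] (φ : GL(2, ℚ)⁺ → ModForms →ₗ[ℂ] N) :
    Crossed →ₗ[ℂ] N where
  toFun a := (Finsupp.lsum ℂ fun γ : (GL(2, ℚ)⁺)ᵐᵒᵖ ↦ φ γ.unop) (SkewMonoidAlgebra.coeff a)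
  map_add' a b := (congrArg _ (SkewMonoidAlgebra.coeff_add a b)).trans (map_add _ _ _)
  map_smul' c a := (congrArg _ (SkewMonoidAlgebra.coeff_smul c a)).trans (map_smul _ _ _)

@[simp] lemma liftU_U {N : Type} [AddCommGroup N] [Module ℂ N]
    (φ : GL(2, ℚ)⁺ → ModForms →ₗ[ℂ] N) (γ : GL(2, ℚ)⁺) (f : ModForms) :
    liftU φ (U γ f) = φ γ f := by
  change (Finsupp.lsum ℂ fun γ : (GL(2, ℚ)⁺)ᵐᵒᵖ ↦ φ γ.unop)
    (Finsupp.single (MulOpposite.op γ) f) = _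
  simp

/-- The linear endomorphism `∑ f U_γ^* ↦ ∑ φ_γ(f) U_γ^*` of the crossed product. -/
def diagonal (φ : GL(2, ℚ)⁺ → ModForms →ₗ[ℂ] ModForms) : Module.End ℂ Crossed :=
  liftU fun γ ↦ U γ ∘ₗ φ γ

@[simp] lemma diagonal_U (φ : GL(2, ℚ)⁺ → ModForms →ₗ[ℂ] ModForms) (γ : GL(2, ℚ)⁺)
    (f : ModForms) : diagonal φ (U γ f) = U γ (φ γ f) := by
  simp [diagonal]

lemma crossed_ext {N : Type} [AddCommGroup N] [Module ℂ N] {φ ψ : Crossed →ₗ[ℂ] N}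
    (h : ∀ γ f, φ (U γ f) = ψ (U γ f)) : φ = ψ := by
  ext a
  refine SkewMonoidAlgebra.induction_on (p := fun a ↦ φ a = ψ a) a ?_ (fun γ f ↦ h γ.unop f) ?_
  · exact (map_zero φ).trans (map_zero ψ).symm
  · intro a b ha hb
    exact (map_add φ a b).trans ((congrArg₂ _ ha hb).trans (map_add ψ a b).symm)

lemma diagonal_mul (φ ψ : GL(2, ℚ)⁺ → ModForms →ₗ[ℂ] ModForms) :
    diagonal φ * diagonal ψ = diagonal fun γ ↦ φ γ ∘ₗ ψ γ :=
  crossed_ext fun γ f ↦ by simp [Module.End.mul_apply]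

/-- The inclusion `f ↦ f U_1^*` of `𝓜` in the crossed product. -/
def ofForm : ModForms →ₗ[ℂ] Crossed := U 1

/-! The operators on `𝓜`. -/

lemma IsModular.mdiff {k : ℕ} {f : ℍ → ℂ} (hf : IsModular k f) : MDiff f :=
  ((isModular_iff k f).mp hf).1

/-- `X : 𝓜ₖ → 𝓜ₖ₊₂`. -/
def XLin (k : ℕ) : M k →ₗ[ℂ] M (k + 2) where
  toFun f := ⟨ramanujan k f, IsModular.ramanujan f.2⟩
  map_add' f g := Subtype.ext <| by
    simp only [ramanujan_eq]
    exact serreDerivative_add _ _ _ (IsModular.mdiff f.2) (IsModular.mdiff g.2)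
  map_smul' c f := Subtype.ext <| by
    simp only [ramanujan_eq]
    exact serreDerivative_smul _ _ _ (IsModular.mdiff f.2)

/-- The operator `X` on `𝓜`. -/
def XM : ModForms →ₗ[ℂ] ModForms := liftM fun k ↦ incl (k + 2) ∘ₗ XLin k

@[simp] lemma XM_incl (k : ℕ) (f : M k) : XM (incl k f) = incl (k + 2) (XLin k f) :=
  liftM_incl ..

/-- The grading operator `Y` on `𝓜`, equal to `k/2` on `𝓜ₖ`. -/
def YM : ModForms →ₗ[ℂ] ModForms := liftM fun k ↦ ((k : ℂ) / 2) • incl k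

@[simp] lemma YM_incl (k : ℕ) (f : M k) : YM (incl k f) = ((k : ℂ) / 2) • incl k f := by
  simp [YM]

/-- `μ_γ` as an element of `𝓜₂`. -/
def mu (γ : GL(2, ℚ)⁺) : M 2 := ⟨muFun γ, isModular_muFun γ⟩

/-- `ω₄ = -E₄/72`. -/
def omegaFour : M 4 := ⟨(-(1 / 72) : ℂ) • ⇑ModularForm.E₄,
  IsModular.smul _ ⟨1, one_ne_zero, ModularForm.E₄.copy _ rfl
    CongruenceSubgroup.Gamma_one_coe_eq_SL, rfl⟩⟩

lemma incl_congr {k l : ℕ} (h : k = l) (f : M k) (g : M l) (hfg : (f : ℍ → ℂ) = g) :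
    incl k f = incl l g := by
  subst h
  rw [Subtype.ext hfg]

lemma XM_mul (a b : ModForms) : XM (a * b) = XM a * b + a * XM b := by
  induction a using modForms_induction with
  | h0 => simp
  | h2 a a' h h' => simp only [add_mul, map_add, h, h']; abel
  | h1 k f =>
    induction b using modForms_induction with
    | h0 => simp
    | h2 b b' h h' => simp only [mul_add, map_add, h, h']; abel
    | h1 l g =>
      have h1 : IsModular (k + l + 2) (ramanujan k f * g) := by
        have := IsModular.mul (IsModular.ramanujan f.2) g.2
        rwa [show k + 2 + l = k + l + 2 by ring] at this
      have h2 : IsModular (k + l + 2) (f * ramanujan l g) := by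
        have := IsModular.mul f.2 (IsModular.ramanujan g.2)
        rwa [show k + (l + 2) = k + l + 2 by ring] at this
      have e1 : XM (incl k f) * incl l g = incl (k + l + 2) ⟨_, h1⟩ := by
        rw [XM_incl, incl_mul]
        exact incl_congr (by ring) _ _ rfl
      have e2 : incl k f * XM (incl l g) = incl (k + l + 2) ⟨_, h2⟩ := by
        rw [XM_incl, incl_mul]
        exact incl_congr (by ring) _ _ rfl
      rw [e1, e2, incl_mul, XM_incl, ← map_add]
      congr 1
      refine Subtype.ext ?_
      change ramanujan (k + l) (f * g) = ramanujan k f * g + f * ramanujan l g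
      simp only [ramanujan_eq]
      have := serreDerivative_mul k l f g (IsModular.mdiff f.2) (IsModular.mdiff g.2)
      push_cast
      exact this

lemma YM_mul (a b : ModForms) : YM (a * b) = YM a * b + a * YM b := by
  induction a using modForms_induction with
  | h0 => simp
  | h2 a a' h h' => simp only [add_mul, map_add, h, h']; abel
  | h1 k f =>
    induction b using modForms_induction with
    | h0 => simp
    | h2 b b' h h' => simp only [mul_add, map_add, h, h']; abel
    | h1 l g =>
      rw [incl_mul, YM_incl, YM_incl, YM_incl, smul_mul_assoc, mul_smul_comm, incl_mul, ← add_smul]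
      push_cast
      ring_nf

lemma YM_XM (a : ModForms) : YM (XM a) = XM (YM a) + XM a := by
  induction a using modForms_induction with
  | h0 => simp
  | h2 a a' h h' => simp only [map_add, h, h']; abel
  | h1 k f =>
    simp only [XM_incl, YM_incl, map_smul]
    push_cast
    module

/-- `X^n(μ_γ)`, the modular form through which `δ_{n+1}` acts. -/
def muIter (n : ℕ) (γ : GL(2, ℚ)⁺) : ModForms := (XM ^ n) (incl 2 (mu γ))

lemma muIter_succ (n : ℕ) (γ : GL(2, ℚ)⁺) : muIter (n + 1) γ = XM (muIter n γ) := by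
  rw [muIter, pow_succ', Module.End.mul_apply]; rfl

lemma YM_muIter (n : ℕ) (γ : GL(2, ℚ)⁺) : YM (muIter n γ) = ((n : ℂ) + 1) • muIter n γ := by
  induction n with
  | zero => simp [muIter]
  | succ n ih => rw [muIter_succ, YM_XM, ih, map_smul]; push_cast; module

/-- The operator `X` on the crossed product. -/
def opX : Module.End ℂ Crossed := diagonal fun _ ↦ XM

/-- The operator `Y` on the crossed product. -/
def opY : Module.End ℂ Crossed := diagonal fun _ ↦ YM

/-- The operator `δ_{n+1}` on the crossed product,
`δ_{n+1}(f U_γ^*) = X^n(μ_γ) f U_γ^*`. -/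
def opD (n : ℕ) : Module.End ℂ Crossed := diagonal fun γ ↦ LinearMap.mulLeft ℂ (muIter n γ)

open scoped TensorProduct

/-! The Hopf algebra `H₁`. -/

/-- The basis of the Lie algebra underlying `H₁`; `d n` stands for `δ_{n+1}`. -/
inductive Gen : Type
  | X : Gen
  | Y : Gen
  | d : ℕ → Gen

/-- The Lie algebra with basis `X, Y, δ₁, δ₂, …`. -/
def LieH : Type := Gen →₀ ℂ

namespace LieH

instance : AddCommGroup LieH := inferInstanceAs (AddCommGroup (Gen →₀ ℂ))

instance : Module ℂ LieH := inferInstanceAs (Module ℂ (Gen →₀ ℂ))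

/-- The basis vectors. -/
def basis (i : Gen) : LieH := Finsupp.single i (1 : ℂ)

/-- The linear map out of the Lie algebra with given values on the basis. -/
def lift {N : Type} [AddCommGroup N] [Module ℂ N] (v : Gen → N) : LieH →ₗ[ℂ] N :=
  Finsupp.linearCombination ℂ v

@[simp] lemma lift_basis {N : Type} [AddCommGroup N] [Module ℂ N] (v : Gen → N) (i : Gen) :
    lift v (basis i) = v i := by
  change Finsupp.linearCombination ℂ v (Finsupp.single i 1) = v i
  simp

lemma hom_ext {N : Type} [AddCommGroup N] [Module ℂ N] {φ ψ : LieH →ₗ[ℂ] N}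
    (h : ∀ i, φ (basis i) = ψ (basis i)) : φ = ψ :=
  Finsupp.lhom_ext' (φ := φ) (ψ := ψ) fun i ↦ LinearMap.ext_ring (h i)

/-- The brackets `[Y, X] = X`, `[Y, δₙ] = n δₙ`, `[X, δₙ] = δₙ₊₁`, `[δₖ, δₗ] = 0` of basis
vectors. -/
def bracketBasis : Gen → Gen → LieH
  | .X, .X => 0
  | .X, .Y => -basis .X
  | .X, .d n => basis (.d (n + 1))
  | .Y, .X => basis .X
  | .Y, .Y => 0
  | .Y, .d n => ((n : ℂ) + 1) • basis (.d n)
  | .d n, .X => -basis (.d (n + 1))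
  | .d n, .Y => -(((n : ℂ) + 1) • basis (.d n))
  | .d _, .d _ => 0

/-- The bracket, as a bilinear map. -/
def bracketLin : LieH →ₗ[ℂ] LieH →ₗ[ℂ] LieH := lift fun i ↦ lift (bracketBasis i)

lemma bracketLin_basis (i j : Gen) : bracketLin (basis i) (basis j) = bracketBasis i j := by
  simp [bracketLin]

lemma bracketLin_swap (x y : LieH) : bracketLin x y = -bracketLin y x := by
  have : bracketLin = -bracketLin.flip := by
    refine hom_ext fun i ↦ hom_ext fun j ↦ ?_
    simp only [LinearMap.neg_apply, LinearMap.flip_apply, bracketLin_basis]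
    cases i <;> cases j <;> simp [bracketBasis]
  exact congrArg (fun φ ↦ φ x y) this

lemma bracketLin_jacobi (x y z : LieH) :
    bracketLin x (bracketLin y z) = bracketLin (bracketLin x y) z + bracketLin y (bracketLin x z) := by
  have : ∀ i j k, bracketLin (basis i) (bracketLin (basis j) (basis k)) =
      bracketLin (bracketLin (basis i) (basis j)) (basis k) +
        bracketLin (basis j) (bracketLin (basis i) (basis k)) := by
    intro i j k
    simp only [bracketLin_basis]
    cases i <;> cases j <;> cases k <;>
      simp [bracketBasis, bracketLin_basis] <;> module
  have h1 : ∀ i j, bracketLin (basis i) ∘ₗ bracketLin (basis j) =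
      bracketLin (bracketLin (basis i) (basis j)) +
        bracketLin (basis j) ∘ₗ bracketLin (basis i) :=
    fun i j ↦ hom_ext fun k ↦ this i j k
  have h2 : ∀ i, LinearMap.llcomp ℂ _ _ _ (bracketLin (basis i)) ∘ₗ bracketLin =
      bracketLin ∘ₗ bracketLin (basis i) +
        (LinearMap.lcomp ℂ _ (bracketLin (basis i))) ∘ₗ bracketLin :=
    fun i ↦ hom_ext fun j ↦ h1 i j
  have h3 : ∀ i, bracketLin (basis i) (bracketLin y z) =
      bracketLin (bracketLin (basis i) y) z + bracketLin y (bracketLin (basis i) z) :=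
    fun i ↦ congrArg (fun φ ↦ φ y z) (h2 i)
  have h4 : bracketLin.flip (bracketLin y z) =
      bracketLin.flip z ∘ₗ bracketLin.flip y + bracketLin y ∘ₗ bracketLin.flip z :=
    hom_ext fun i ↦ h3 i
  exact congrArg (fun φ ↦ φ x) h4

instance : LieRing LieH where
  bracket x y := bracketLin x y
  add_lie x y z := by simp
  lie_add x y z := by simp
  lie_self x := by
    have h : bracketLin x x = -bracketLin x x := bracketLin_swap x x
    have : (2 : ℂ) • bracketLin x x = 0 := by
      rw [two_smul]; nth_rewrite 1 [h]; simp
    exact (smul_eq_zero.mp this).resolve_left two_ne_zero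
  leibniz_lie x y z := bracketLin_jacobi x y z

instance : LieAlgebra ℂ LieH where
  lie_smul c x y := map_smul (bracketLin x) c y

lemma basis_lie (i j : Gen) : ⁅basis i, basis j⁆ = bracketBasis i j := bracketLin_basis i j

end LieH

/-- The algebra `H₁`, the enveloping algebra of `LieH`. -/
def H1 : Type := UniversalEnvelopingAlgebra ℂ LieH

namespace H1

instance : Ring H1 := inferInstanceAs (Ring (UniversalEnvelopingAlgebra ℂ LieH))

instance : Algebra ℂ H1 := inferInstanceAs (Algebra ℂ (UniversalEnvelopingAlgebra ℂ LieH))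

attribute [local instance] LieRing.ofAssociativeRing in
/-- The images of the basis vectors in `H₁`. -/
def gen (i : Gen) : H1 := UniversalEnvelopingAlgebra.ι ℂ (LieH.basis i)

/-- The generator `X`. -/
def X : H1 := gen .X

/-- The generator `Y`. -/
def Y : H1 := gen .Y

/-- The generator `δ_{n+1}`. -/
def d (n : ℕ) : H1 := gen (.d n)

attribute [local instance] LieRing.ofAssociativeRing in
lemma gen_comm (i j : Gen) : gen i * gen j - gen j * gen i =
    UniversalEnvelopingAlgebra.ι ℂ (LieH.bracketBasis i j) := by
  rw [← LieH.basis_lie, LieHom.map_lie]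
  rfl

lemma comm_YX : Y * X - X * Y = X := gen_comm .Y .X

lemma comm_Yd (n : ℕ) : Y * d n - d n * Y = ((n : ℂ) + 1) • d n :=
  (gen_comm .Y (.d n)).trans (map_smul _ _ _)

lemma comm_Xd (n : ℕ) : X * d n - d n * X = d (n + 1) := gen_comm .X (.d n)

lemma comm_dd (k l : ℕ) : d k * d l = d l * d k := by
  rw [← sub_eq_zero]
  exact (gen_comm (.d k) (.d l)).trans (map_zero _)

/-- Prescribed images of the basis vectors. -/
def liftGen {B : Type} (x y : B) (e : ℕ → B) : Gen → B
  | .X => x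
  | .Y => y
  | .d n => e n

lemma lift_aux {B : Type} [Ring B] [Algebra ℂ B] (x y : B) (e : ℕ → B)
    (hyx : y * x - x * y = x) (hye : ∀ n, y * e n - e n * y = ((n : ℂ) + 1) • e n)
    (hxe : ∀ n, x * e n - e n * x = e (n + 1)) (hee : ∀ k l, e k * e l = e l * e k) (u v : LieH) :
    LieH.lift (liftGen x y e) (LieH.bracketLin u v) =
      LieH.lift (liftGen x y e) u * LieH.lift (liftGen x y e) v -
        LieH.lift (liftGen x y e) v * LieH.lift (liftGen x y e) u := by
  set φ := LieH.lift (liftGen x y e) with hφ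
  have : LieH.bracketLin.compr₂ φ =
      (LinearMap.mul ℂ B).compl₁₂ φ φ - (LinearMap.mul ℂ B).flip.compl₁₂ φ φ := by
    refine LieH.hom_ext fun i ↦ LieH.hom_ext fun j ↦ ?_
    simp only [LinearMap.compr₂_apply, LieH.bracketLin_basis, LinearMap.sub_apply,
      LinearMap.compl₁₂_apply, LinearMap.mul_apply', LinearMap.flip_apply, hφ, LieH.lift_basis]
    cases i <;> cases j <;>
      simp only [LieH.bracketBasis, liftGen, map_zero, map_neg, map_smul, LieH.lift_basis, sub_self,
        hyx, hye, hxe, hee]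
    · rw [← neg_sub, hyx]
    · rw [← neg_sub, hxe]
    · rw [← neg_sub, hye]
  exact congrArg (fun ψ ↦ ψ u v) this

attribute [local instance] LieRing.ofAssociativeRing in
/-- The algebra map out of `H₁` determined by elements satisfying the commutation relations. -/
def lift {B : Type} [Ring B] [Algebra ℂ B] (x y : B) (e : ℕ → B)
    (hyx : y * x - x * y = x) (hye : ∀ n, y * e n - e n * y = ((n : ℂ) + 1) • e n)
    (hxe : ∀ n, x * e n - e n * x = e (n + 1)) (hee : ∀ k l, e k * e l = e l * e k) :
    H1 →ₐ[ℂ] B :=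
  UniversalEnvelopingAlgebra.lift ℂ
    { LieH.lift (liftGen x y e) with
      map_lie' := fun {u v} ↦ lift_aux x y e hyx hye hxe hee u v }

attribute [local instance] LieRing.ofAssociativeRing in
lemma lift_gen {B : Type} [Ring B] [Algebra ℂ B] (x y : B) (e : ℕ → B)
    (hyx : y * x - x * y = x) (hye : ∀ n, y * e n - e n * y = ((n : ℂ) + 1) • e n)
    (hxe : ∀ n, x * e n - e n * x = e (n + 1)) (hee : ∀ k l, e k * e l = e l * e k) (i : Gen) :
    lift x y e hyx hye hxe hee (gen i) = liftGen x y e i :=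
  (UniversalEnvelopingAlgebra.lift_ι_apply ℂ _ _).trans (LieH.lift_basis _ _)

attribute [local instance] LieRing.ofAssociativeRing in
/-- `X`, `Y` and `δ₁` generate `H₁`. -/
lemma algHom_ext {B : Type} [Ring B] [Algebra ℂ B] {f g : H1 →ₐ[ℂ] B} (hX : f X = g X)
    (hY : f Y = g Y) (hd : f (d 0) = g (d 0)) : f = g := by
  have hdn : ∀ n, f (d n) = g (d n) := by
    intro n
    induction n with
    | zero => exact hd
    | succ n ih => rw [← comm_Xd, map_sub, map_sub, map_mul, map_mul, map_mul, map_mul, hX, ih]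
  refine UniversalEnvelopingAlgebra.hom_ext ℂ (LieHom.ext fun v ↦ ?_)
  have : f.toLinearMap ∘ₗ (UniversalEnvelopingAlgebra.ι ℂ : LieH →ₗ⁅ℂ⁆ _).toLinearMap =
      g.toLinearMap ∘ₗ (UniversalEnvelopingAlgebra.ι ℂ : LieH →ₗ⁅ℂ⁆ _).toLinearMap :=
    LieH.hom_ext fun i ↦ by
      cases i with
      | X => exact hX
      | Y => exact hY
      | d n => exact hdn n
  exact congrArg (fun ψ ↦ ψ v) this

section liftRec

variable {B : Type} [Ring B] [Algebra ℂ B] (x y e₀ : B)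

/-- The iterated commutators `[x, [x, …, [x, e₀]]]`. -/
def iter : ℕ → B
  | 0 => e₀
  | n + 1 => x * iter n - iter n * x

variable {x y e₀} in
lemma iter_mem {S : Subalgebra ℂ B} (h0 : e₀ ∈ S) (hx : ∀ s ∈ S, x * s - s * x ∈ S) (n : ℕ) :
    iter x e₀ n ∈ S := by
  induction n with
  | zero => exact h0
  | succ n ih => exact hx _ ih

variable {x y e₀} in
lemma iter_comm_y (hyx : y * x - x * y = x) (hy : y * e₀ - e₀ * y = e₀) (n : ℕ) :
    y * iter x e₀ n - iter x e₀ n * y = ((n : ℂ) + 1) • iter x e₀ n := by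
  induction n with
  | zero => simpa [iter] using hy
  | succ n ih =>
    set e := iter x e₀ n
    have : y * (x * e - e * x) - (x * e - e * x) * y =
        ((y * x - x * y) * e - e * (y * x - x * y)) +
          (x * (y * e - e * y) - (y * e - e * y) * x) := by noncomm_ring
    change y * (x * e - e * x) - (x * e - e * x) * y = _ • (x * e - e * x)
    rw [this, ih, hyx, mul_smul_comm, smul_mul_assoc, ← smul_sub]
    push_cast
    module

/-- The algebra map out of `H₁` determined by the images of `X`, `Y` and `δ₁`. -/
def liftRec (S : Subalgebra ℂ B) (hS : ∀ s ∈ S, ∀ s' ∈ S, s * s' = s' * s)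
    (hyx : y * x - x * y = x) (hy : y * e₀ - e₀ * y = e₀) (h0 : e₀ ∈ S)
    (hx : ∀ s ∈ S, x * s - s * x ∈ S) : H1 →ₐ[ℂ] B :=
  lift x y (iter x e₀) hyx (iter_comm_y hyx hy) (fun _ ↦ rfl)
    fun _ _ ↦ hS _ (iter_mem h0 hx _) _ (iter_mem h0 hx _)

variable (S : Subalgebra ℂ B) (hS : ∀ s ∈ S, ∀ s' ∈ S, s * s' = s' * s)
    (hyx : y * x - x * y = x) (hy : y * e₀ - e₀ * y = e₀) (h0 : e₀ ∈ S)
    (hx : ∀ s ∈ S, x * s - s * x ∈ S)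

lemma liftRec_X : liftRec x y e₀ S hS hyx hy h0 hx X = x := lift_gen _ _ _ _ _ _ _ Gen.X

lemma liftRec_Y : liftRec x y e₀ S hS hyx hy h0 hx Y = y := lift_gen _ _ _ _ _ _ _ Gen.Y

lemma liftRec_d : liftRec x y e₀ S hS hyx hy h0 hx (d 0) = e₀ :=
  lift_gen _ _ _ _ _ _ _ (Gen.d 0)

end liftRec

lemma adjoin_comm {B : Type} [Ring B] [Algebra ℂ B] {T : Set B}
    (hT : ∀ s ∈ T, ∀ s' ∈ T, s * s' = s' * s) :
    ∀ s ∈ Algebra.adjoin ℂ T, ∀ s' ∈ Algebra.adjoin ℂ T, s * s' = s' * s := by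
  intro s hs s' hs'
  have := Algebra.isMulCommutative_adjoin ℂ hT
  exact congrArg Subtype.val (mul_comm' (⟨s, hs⟩ : Algebra.adjoin ℂ T) ⟨s', hs'⟩)

lemma adjoin_comm_mem {B : Type} [Ring B] [Algebra ℂ B] {T : Set B} {x : B}
    (hT : ∀ s ∈ T, x * s - s * x ∈ Algebra.adjoin ℂ T) :
    ∀ s ∈ Algebra.adjoin ℂ T, x * s - s * x ∈ Algebra.adjoin ℂ T := by
  intro s hs
  induction hs using Algebra.adjoin_induction with
  | mem s hs => exact hT s hs
  | algebraMap c => rw [Algebra.commutes c x, sub_self]; exact zero_mem _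
  | add s t _ _ h h' =>
    rw [show x * (s + t) - (s + t) * x = (x * s - s * x) + (x * t - t * x) by noncomm_ring]
    exact add_mem h h'
  | mul s t hs ht h h' =>
    rw [show x * (s * t) - s * t * x = (x * s - s * x) * t + s * (x * t - t * x) by noncomm_ring]
    exact add_mem (mul_mem h ht) (mul_mem hs h')

/-- The elements `δₙ ⊗ 1` and `1 ⊗ δₙ`. -/
def tensorSet : Set (H1 ⊗[ℂ] H1) :=
  {s | ∃ n, s = d n ⊗ₜ[ℂ] (1 : H1) ∨ s = (1 : H1) ⊗ₜ[ℂ] d n}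

lemma mem_left (n : ℕ) : d n ⊗ₜ[ℂ] (1 : H1) ∈ Algebra.adjoin ℂ tensorSet :=
  Algebra.subset_adjoin (show _ ∈ tensorSet from ⟨n, Or.inl rfl⟩)

lemma mem_right (n : ℕ) : (1 : H1) ⊗ₜ[ℂ] d n ∈ Algebra.adjoin ℂ tensorSet :=
  Algebra.subset_adjoin (show _ ∈ tensorSet from ⟨n, Or.inr rfl⟩)

/-- `Δ X = X ⊗ 1 + 1 ⊗ X + δ₁ ⊗ Y`. -/
def comulX : H1 ⊗[ℂ] H1 := X ⊗ₜ[ℂ] (1 : H1) + (1 : H1) ⊗ₜ[ℂ] X + d 0 ⊗ₜ[ℂ] Y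

/-- `Δ Y = Y ⊗ 1 + 1 ⊗ Y`. -/
def comulY : H1 ⊗[ℂ] H1 := Y ⊗ₜ[ℂ] (1 : H1) + (1 : H1) ⊗ₜ[ℂ] Y

/-- `Δ δ₁ = δ₁ ⊗ 1 + 1 ⊗ δ₁`. -/
def comulD : H1 ⊗[ℂ] H1 := d 0 ⊗ₜ[ℂ] (1 : H1) + (1 : H1) ⊗ₜ[ℂ] d 0

lemma YX : Y * X = X * Y + X := by rw [← sub_eq_iff_eq_add', comm_YX]

lemma Yd (n : ℕ) : Y * d n = d n * Y + ((n : ℂ) + 1) • d n := by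
  rw [← sub_eq_iff_eq_add', comm_Yd]

lemma Xd (n : ℕ) : X * d n = d n * X + d (n + 1) := by rw [← sub_eq_iff_eq_add', comm_Xd]

/-- The coproduct, the algebra map with `Δ Y = Y ⊗ 1 + 1 ⊗ Y`,
`Δ X = X ⊗ 1 + 1 ⊗ X + δ₁ ⊗ Y` and `Δ δ₁ = δ₁ ⊗ 1 + 1 ⊗ δ₁`. -/
def comulHom : H1 →ₐ[ℂ] H1 ⊗[ℂ] H1 :=
  liftRec comulX comulY comulD (Algebra.adjoin ℂ tensorSet)
    (adjoin_comm <| by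
      rintro _ ⟨n, rfl | rfl⟩ _ ⟨m, rfl | rfl⟩ <;>
        simp [Algebra.TensorProduct.tmul_mul_tmul, comm_dd n m])
    (by
      simp only [comulX, comulY, add_mul, mul_add, Algebra.TensorProduct.tmul_mul_tmul, mul_one,
        one_mul, YX, Yd 0, TensorProduct.add_tmul, TensorProduct.tmul_add]
      simp
      abel)
    (by
      simp only [comulD, comulY, add_mul, mul_add, Algebra.TensorProduct.tmul_mul_tmul, mul_one,
        one_mul, Yd 0, TensorProduct.add_tmul, TensorProduct.tmul_add]
      simp
      abel)
    (by rw [comulD]; exact add_mem (mem_left 0) (mem_right 0))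
    (adjoin_comm_mem <| by
      rintro _ ⟨n, rfl | rfl⟩
      · have : comulX * d n ⊗ₜ[ℂ] (1 : H1) - d n ⊗ₜ[ℂ] (1 : H1) * comulX =
            d (n + 1) ⊗ₜ[ℂ] (1 : H1) := by
          simp only [comulX, add_mul, mul_add, Algebra.TensorProduct.tmul_mul_tmul, mul_one,
            one_mul, Xd, TensorProduct.add_tmul, comm_dd 0 n]
          abel
        rw [this]
        exact mem_left (n + 1)
      · have : comulX * (1 : H1) ⊗ₜ[ℂ] d n - (1 : H1) ⊗ₜ[ℂ] d n * comulX =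
            (1 : H1) ⊗ₜ[ℂ] d (n + 1) +
              ((n : ℂ) + 1) • (d 0 ⊗ₜ[ℂ] (1 : H1) * (1 : H1) ⊗ₜ[ℂ] d n) := by
          simp only [comulX, add_mul, mul_add, Algebra.TensorProduct.tmul_mul_tmul, mul_one,
            one_mul, Xd, Yd, TensorProduct.tmul_add, TensorProduct.tmul_smul]
          abel
        rw [this]
        exact add_mem (mem_right (n + 1)) (Subalgebra.smul_mem _
          (mul_mem (mem_left 0)
            (mem_right n)) _))

@[simp] lemma comulHom_X : comulHom X = comulX := by rw [comulHom, liftRec_X]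
@[simp] lemma comulHom_Y : comulHom Y = comulY := by rw [comulHom, liftRec_Y]
@[simp] lemma comulHom_d : comulHom (d 0) = comulD := by rw [comulHom, liftRec_d]

/-- The counit, vanishing on `X`, `Y` and all `δₙ`. -/
def counitHom : H1 →ₐ[ℂ] ℂ := lift 0 0 (fun _ ↦ 0) (by simp) (by simp) (by simp) (by simp)

@[simp] lemma counitHom_X : counitHom X = 0 := lift_gen ..
@[simp] lemma counitHom_Y : counitHom Y = 0 := lift_gen ..
@[simp] lemma counitHom_d (n : ℕ) : counitHom (d n) = 0 := lift_gen ..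

instance : Bialgebra ℂ H1 := Bialgebra.ofAlgHom comulHom counitHom
  (by
    refine algHom_ext ?_ ?_ ?_ <;>
    · simp [comulX, comulY, comulD, TensorProduct.add_tmul, TensorProduct.tmul_add,
        Algebra.TensorProduct.one_def]
      try abel)
  (by refine algHom_ext ?_ ?_ ?_ <;> simp [comulX, comulY, comulD])
  (by refine algHom_ext ?_ ?_ ?_ <;> simp [comulX, comulY, comulD])

/-- The elements `δₙ` of the opposite algebra. -/
def opSet : Set H1ᵐᵒᵖ := {s | ∃ n, s = MulOpposite.op (d n)}

lemma mem_op (n : ℕ) : MulOpposite.op (d n) ∈ Algebra.adjoin ℂ opSet :=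
  Algebra.subset_adjoin (show _ ∈ opSet from ⟨n, rfl⟩)

open MulOpposite in
/-- The antipode as an algebra map to the opposite algebra: `S(Y) = -Y`,
`S(X) = -X + δ₁ Y`, `S(δ₁) = -δ₁`. -/
def antipodeHom : H1 →ₐ[ℂ] H1ᵐᵒᵖ :=
  liftRec (op (-X + d 0 * Y)) (op (-Y)) (op (-d 0)) (Algebra.adjoin ℂ opSet)
    (adjoin_comm <| by
      rintro _ ⟨n, rfl⟩ _ ⟨m, rfl⟩
      rw [← op_mul, ← op_mul, comm_dd])
    (by
      rw [← op_mul, ← op_mul, ← op_sub]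
      congr 1
      have h := Yd 0
      simp only [Nat.cast_zero, zero_add, one_smul] at h
      have : (-X + d 0 * Y) * -Y - -Y * (-X + d 0 * Y) =
        X * Y - d 0 * Y * Y - Y * X + (Y * d 0) * Y := by noncomm_ring
      rw [this, YX, h]
      noncomm_ring)
    (by
      rw [← op_mul, ← op_mul, ← op_sub]
      congr 1
      have h := Yd 0
      simp only [Nat.cast_zero, zero_add, one_smul] at h
      have : -d 0 * -Y - -Y * -d 0 = d 0 * Y - Y * d 0 := by noncomm_ring
      rw [this, h]
      noncomm_ring)
    (by rw [op_neg]; exact neg_mem (mem_op 0))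
    (adjoin_comm_mem <| by
      rintro _ ⟨n, rfl⟩
      have : op (-X + d 0 * Y) * op (d n) - op (d n) * op (-X + d 0 * Y) =
          op (d (n + 1)) - ((n : ℂ) + 1) • (op (d n) * op (d 0)) := by
        rw [← op_mul, ← op_mul, ← op_mul, ← op_smul, ← op_sub, ← op_sub]
        congr 1
        have : d n * (-X + d 0 * Y) - (-X + d 0 * Y) * d n =
          X * d n - d n * X + d n * d 0 * Y - d 0 * (Y * d n) := by noncomm_ring
        rw [this, comm_Xd, Yd, mul_add, ← mul_assoc, comm_dd n 0, mul_smul_comm]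
        abel
      rw [this]
      exact sub_mem (mem_op (n + 1)) (Subalgebra.smul_mem _
        (mul_mem (mem_op n) (mem_op 0)) _))

/-- The antipode. -/
def antipodeLin : H1 →ₗ[ℂ] H1 :=
  (MulOpposite.opLinearEquiv ℂ).symm.toLinearMap ∘ₗ antipodeHom.toLinearMap

lemma antipodeLin_mul (a b : H1) : antipodeLin (a * b) = antipodeLin b * antipodeLin a := by
  simp [antipodeLin]

lemma antipodeLin_one : antipodeLin 1 = 1 := by simp [antipodeLin]
lemma antipodeLin_X : antipodeLin X = -X + d 0 * Y := by
  simp [antipodeLin, antipodeHom, liftRec_X]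
lemma antipodeLin_Y : antipodeLin Y = -Y := by
  simp [antipodeLin, antipodeHom, liftRec_Y]
lemma antipodeLin_d : antipodeLin (d 0) = -d 0 := by
  simp [antipodeLin, antipodeHom, liftRec_d]

/-- Induction along the generators `X`, `Y`, `δ₁`. -/
lemma gen_induction (S : Subalgebra ℂ H1) (hX : X ∈ S) (hY : Y ∈ S) (hd : d 0 ∈ S) (h : H1) :
    h ∈ S := by
  have hdn : ∀ n, d n ∈ S := by
    intro n
    induction n with
    | zero => exact hd
    | succ n ih => rw [← comm_Xd]; exact sub_mem (mul_mem hX ih) (mul_mem ih hX)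
  let x : S := ⟨X, hX⟩
  let y : S := ⟨Y, hY⟩
  let e : ℕ → S := fun n ↦ ⟨d n, hdn n⟩
  have h1 : y * x - x * y = x := Subtype.ext comm_YX
  have h2 : ∀ n, y * e n - e n * y = ((n : ℂ) + 1) • e n := fun n ↦ Subtype.ext (comm_Yd n)
  have h3 : ∀ n, x * e n - e n * x = e (n + 1) := fun n ↦ Subtype.ext (comm_Xd n)
  have h4 : ∀ k l, e k * e l = e l * e k := fun k l ↦ Subtype.ext (comm_dd k l)
  let φ : H1 →ₐ[ℂ] S := lift x y e h1 h2 h3 h4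
  have : S.val.comp φ = AlgHom.id ℂ H1 := by
    refine algHom_ext ?_ ?_ ?_
    · exact congrArg Subtype.val (lift_gen x y e h1 h2 h3 h4 Gen.X)
    · exact congrArg Subtype.val (lift_gen x y e h1 h2 h3 h4 Gen.Y)
    · exact congrArg Subtype.val (lift_gen x y e h1 h2 h3 h4 (Gen.d 0))
  rw [← AlgHom.id_apply (R := ℂ) h, ← this]
  exact (φ h).2

lemma rTensor_mul (s t : H1 ⊗[ℂ] H1) (c : ℂ)
    (hs : LinearMap.mul' ℂ H1 (antipodeLin.rTensor H1 s) = algebraMap ℂ H1 c) :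
    LinearMap.mul' ℂ H1 (antipodeLin.rTensor H1 (s * t)) =
      c • LinearMap.mul' ℂ H1 (antipodeLin.rTensor H1 t) := by
  induction t with
  | zero => simp
  | add t t' h h' => rw [mul_add, map_add, map_add, h, h', map_add, map_add, smul_add]
  | tmul a b =>
    have : LinearMap.mul' ℂ H1 (antipodeLin.rTensor H1 (s * a ⊗ₜ[ℂ] b)) =
        antipodeLin a * LinearMap.mul' ℂ H1 (antipodeLin.rTensor H1 s) * b := by
      clear hs
      induction s with
      | zero => simp
      | add t t' h h' => simp only [add_mul, mul_add, map_add, h, h']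
      | tmul x y => simp [antipodeLin_mul, mul_assoc]
    rw [this, hs]
    simp [Algebra.algebraMap_eq_smul_one]

lemma lTensor_mul (s t : H1 ⊗[ℂ] H1) (c : ℂ)
    (ht : LinearMap.mul' ℂ H1 (antipodeLin.lTensor H1 t) = algebraMap ℂ H1 c) :
    LinearMap.mul' ℂ H1 (antipodeLin.lTensor H1 (s * t)) =
      c • LinearMap.mul' ℂ H1 (antipodeLin.lTensor H1 s) := by
  induction s with
  | zero => simp
  | add t t' h h' => rw [add_mul, map_add, map_add, h, h', map_add, map_add, smul_add]
  | tmul a b =>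
    have : LinearMap.mul' ℂ H1 (antipodeLin.lTensor H1 (a ⊗ₜ[ℂ] b * t)) =
        a * LinearMap.mul' ℂ H1 (antipodeLin.lTensor H1 t) * antipodeLin b := by
      clear ht
      induction t with
      | zero => simp
      | add t t' h h' => simp only [add_mul, mul_add, map_add, h, h']
      | tmul x y => simp [antipodeLin_mul, mul_assoc]
    rw [this, ht]
    simp [Algebra.algebraMap_eq_smul_one]

lemma antipode_left (h : H1) : LinearMap.mul' ℂ H1 (antipodeLin.rTensor H1 (comulHom h)) =
    algebraMap ℂ H1 (counitHom h) := by
  refine gen_induction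
    { carrier := {h | LinearMap.mul' ℂ H1 (antipodeLin.rTensor H1 (comulHom h)) =
        algebraMap ℂ H1 (counitHom h)}
      mul_mem' := fun {a b} ha hb ↦ by
        have := rTensor_mul (comulHom a) (comulHom b) _ ha
        rw [Set.mem_ofPred_eq] at hb
        rw [Set.mem_ofPred_eq, map_mul, this, hb, map_mul, map_mul, Algebra.smul_def]
      add_mem' := fun {a b} ha hb ↦ by
        rw [Set.mem_ofPred_eq] at *
        simp only [map_add, ha, hb]
      algebraMap_mem' := fun c ↦ by
        simp [Algebra.TensorProduct.one_def, Algebra.algebraMap_eq_smul_one, antipodeLin_one] }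
    ?_ ?_ ?_ h
  · simp [comulX, antipodeLin_X, antipodeLin_d, antipodeLin_one]
  · simp [comulY, antipodeLin_Y, antipodeLin_one]
  · simp [comulD, antipodeLin_d, antipodeLin_one]

lemma antipode_right (h : H1) : LinearMap.mul' ℂ H1 (antipodeLin.lTensor H1 (comulHom h)) =
    algebraMap ℂ H1 (counitHom h) := by
  refine gen_induction
    { carrier := {h | LinearMap.mul' ℂ H1 (antipodeLin.lTensor H1 (comulHom h)) =
        algebraMap ℂ H1 (counitHom h)}
      mul_mem' := fun {a b} ha hb ↦ by
        have := lTensor_mul (comulHom a) (comulHom b) _ hb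
        rw [Set.mem_ofPred_eq] at ha
        rw [Set.mem_ofPred_eq, map_mul, this, ha, Algebra.smul_def, ← map_mul, map_mul counitHom,
          mul_comm]
      add_mem' := fun {a b} ha hb ↦ by
        rw [Set.mem_ofPred_eq] at *
        simp only [map_add, ha, hb]
      algebraMap_mem' := fun c ↦ by
        simp [Algebra.TensorProduct.one_def, Algebra.algebraMap_eq_smul_one, antipodeLin_one] }
    ?_ ?_ ?_ h
  · simp [comulX, antipodeLin_X, antipodeLin_Y, antipodeLin_one]
  · simp [comulY, antipodeLin_Y, antipodeLin_one]
  · simp [comulD, antipodeLin_d, antipodeLin_one]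

/-- The Hopf algebra `H₁`. -/
instance : HopfAlgebra ℂ H1 where
  antipode := antipodeLin
  mul_antipode_rTensor_comul := LinearMap.ext antipode_left
  mul_antipode_lTensor_comul := LinearMap.ext antipode_right

end H1

/-! The action of `H₁` on the crossed product, 1-cocycles and conjugation. -/

lemma diagonal_sub (φ ψ : GL(2, ℚ)⁺ → ModForms →ₗ[ℂ] ModForms) :
    diagonal φ - diagonal ψ = diagonal fun γ ↦ φ γ - ψ γ :=
  crossed_ext fun γ f ↦ by simp

lemma diagonal_smul (c : ℂ) (φ : GL(2, ℚ)⁺ → ModForms →ₗ[ℂ] ModForms) :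
    c • diagonal φ = diagonal fun γ ↦ c • φ γ :=
  crossed_ext fun γ f ↦ by simp

lemma opY_opX : opY * opX - opX * opY = opX := by
  simp only [opX, opY, diagonal_mul, diagonal_sub]
  congr 1
  ext γ a : 2
  simp [YM_XM]

lemma opY_opD (n : ℕ) : opY * opD n - opD n * opY = ((n : ℂ) + 1) • opD n := by
  simp only [opD, opY, diagonal_mul, diagonal_sub, diagonal_smul]
  congr 1
  ext γ a : 2
  simp [YM_mul, YM_muIter]

lemma opX_opD (n : ℕ) : opX * opD n - opD n * opX = opD (n + 1) := by
  simp only [opD, opX, diagonal_mul, diagonal_sub]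
  congr 1
  ext γ a : 2
  simp [XM_mul, muIter_succ]

lemma opD_opD (k l : ℕ) : opD k * opD l = opD l * opD k := by
  simp only [opD, diagonal_mul]
  congr 1
  ext γ a : 2
  simp [mul_left_comm]

/-- The action of `H₁` on the crossed product. -/
def action : H1 →ₐ[ℂ] Module.End ℂ Crossed :=
  H1.lift opX opY opD opY_opX opY_opD opX_opD opD_opD

lemma action_X : action H1.X = opX := H1.lift_gen _ _ _ _ _ _ _ Gen.X

lemma action_Y : action H1.Y = opY := H1.lift_gen _ _ _ _ _ _ _ Gen.Y

lemma action_d (n : ℕ) : action (H1.d n) = opD n := H1.lift_gen _ _ _ _ _ _ _ (Gen.d n)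

/-- The element `δ₂' = δ₂ - δ₁² / 2` of `H₁`, the Schwarzian. -/
def schwarzian : H1 := H1.d 1 - (1 / 2 : ℂ) • H1.d 0 ^ 2

/-- The algebra of linear maps from `H₁` to the crossed product, under convolution
`(u * v)(h) = ∑ u(h₁) v(h₂)`, with unit `h ↦ ε(h) 1`. -/
abbrev Conv : Type := WithConv (H1 →ₗ[ℂ] Crossed)

/-- The linear map `h ↦ h(a)`. -/
def orbit (a : Crossed) : Conv := WithConv.toConv (action.toLinearMap.flip a)

lemma orbit_apply (a : Crossed) (h : H1) : orbit a h = action h a := rfl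

/-- A convolution-invertible linear map `u` is a 1-cocycle if
`u(h h') = ∑ u(h₁) h₂(u(h'))` for all `h`, `h'` in `H₁`. -/
def IsOneCocycle (u : Convˣ) : Prop :=
  ∀ h h' : H1, (u : Conv) (h * h') = ((u : Conv) * orbit ((u : Conv) h')) h

/-- The conjugate under `u` of the action of `H₁`, `h̃(a) = ∑ u(h₁) h₂(a) u⁻¹(h₃)`. -/
def conjAction (u : Convˣ) (h : H1) (a : Crossed) : Crossed :=
  ((u : Conv) * orbit a * ((u⁻¹ : Convˣ) : Conv)) h

/-- The inner derivation `a ↦ [b, a] = b a - a b` of the crossed product. -/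
def ad (b a : Crossed) : Crossed := b * a - a * b

end ModularHecke

end

noncomputable section

namespace ModularHecke

open UpperHalfPlane Derivative
open scoped MatrixGroups ModularForm Manifold CongruenceSubgroup TensorProduct

/-! Values at the cusp and Ramanujan's formula for the derivative of `E₂`. -/

/-! Write `D` for the normalized derivative and φ = `dlog etaFour`, so that μ_γ = `dlog (η⁴|γ)` - φ.
The proof has an algebraic half and an analytic half.

Algebra. If `u` is a cocycle, each of the maps h ↦ ∑ u(h₁) h₂(·), h ↦ ∑ h₁(·) u⁻¹(h₂) and h ↦ ∑
u(h₁) h₂(·) u⁻¹(h₃) is a representation of `H1`. For the values prescribed here all three act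
diagonally on the components of U_γ^*, with explicit coefficients (`DiagRep`). The argument runs
backwards: the three representations are written down directly as `twistRep`, `cotwistRep` and
`conjRep`. A Leibniz rule P(h)(ab) = ∑ Q(h₁)(a) R(h₂)(b) need only be checked on X, Y and δ₁
(`leibniz_of_generators`), where it becomes a few identities between coefficients (`leibniz`).
Evaluating `twistRep` at 1 gives `u` and evaluating `cotwistRep` at 1 gives its inverse. The cocycle
identity is multiplicativity of `twistRep`, and the conjugate action is `conjRep`, from which the
formulas are read off. Uniqueness holds because X, Y and δ₁ generate `H1` and the cocycle identity
propagates values along products (`IsOneCocycle.ext`).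

Analysis. The expression Dφ - φ²/2 transforms as a form of weight 4 (`schwarz_slash`). It has level
one and constant term -1/72, so it equals ω₄ (`schwarz_etaFour`, which is Ramanujan's formula for
DE₂). Hence X(μ_γ) - μ_γ²/2 = ω₄|γ - ω₄ (`XM_mu`), which makes the conjugate of δ₂' an inner
derivation. If X(m) + m²/2 = ω₄, then ψ = φ - m satisfies the Riccati equation Dψ = ψ²/2. Its
nonzero solutions are locally 1/(b - πi z), which is not periodic, so ψ = 0; this contradicts the
quasimodular transformation law of φ (`no_solution`). Finally, the inner derivation of a weight 4
form Ω vanishes only if Ω is invariant under all of GL⁺(2, ℚ), and such a form is zero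
(`eq_zero_of_slash_invariant`). -/

lemma tendsto_of_hasSum_qExpansion {f : ℍ → ℂ} {c : ℕ → ℂ}
    (hf : ∀ τ : ℍ, HasSum (fun m ↦ c m • Function.Periodic.qParam 1 τ ^ m) (f τ)) :
    Filter.Tendsto f atImInfty (nhds (c 0)) := by
  set q : ℍ → ℂ := fun τ ↦ Function.Periodic.qParam 1 τ with hq
  have hq0 (τ : ℍ) : q τ ≠ 0 := Function.Periodic.qParam_ne_zero _
  -- Dividing f - c₀ by q shifts the coefficients by one, so the quotient is again given by a
  -- q-expansion and is bounded; multiplying back by q → 0 gives the limit.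
  have hg : IsBoundedAtImInfty fun τ ↦ (f τ - c 0) * (q τ)⁻¹ := by
    refine isBoundedAtImInfty_of_hasSum_qExpansion (h := 1) (c := fun m ↦ c (m + 1)) one_pos
      fun τ ↦ ?_
    have h := (((hasSum_nat_add_iff' 1).mpr (hf τ))).mul_right (q τ)⁻¹
    simp only [Finset.range_one, Finset.sum_singleton, pow_zero, smul_eq_mul, mul_one] at h
    refine h.congr_fun fun m ↦ ?_
    change c (m + 1) * q τ ^ m = c (m + 1) * q τ ^ (m + 1) * (q τ)⁻¹
    rw [pow_succ, mul_assoc, mul_assoc, mul_inv_cancel₀ (hq0 τ), mul_one]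
  have hz : IsZeroAtImInfty fun τ ↦ (f τ - c 0) * (q τ)⁻¹ * q τ := by
    refine (Asymptotics.IsBigO.mul hg
      (Asymptotics.isBigO_refl q atImInfty).norm_right).trans_tendsto ?_
    simpa using (qParam_tendsto_atImInfty one_pos).norm
  have : f = fun τ ↦ (f τ - c 0) * (q τ)⁻¹ * q τ + c 0 := by
    ext τ
    rw [mul_assoc, inv_mul_cancel₀ (hq0 τ)]
    ring
  rw [this]
  simpa using hz.add_const (c 0)

/-- Cauchy's estimate on the unit disc around z bounds the derivative by the supremum of f on that
disc. -/
lemma isZeroAtImInfty_deriv {f : ℍ → ℂ} (hf : MDiff f) (h0 : IsZeroAtImInfty f) :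
    IsZeroAtImInfty (normalizedDerivOfComplex f) := by
  rw [isZeroAtImInfty_iff] at h0 ⊢
  intro ε hε
  have h2 : 0 < ‖(2 * Real.pi * Complex.I : ℂ)‖ := norm_pos_iff.mpr Complex.two_pi_I_ne_zero
  obtain ⟨A, h⟩ := h0 (ε * ‖(2 * Real.pi * Complex.I : ℂ)‖) (by positivity)
  -- The margin 2 keeps the closed unit disc around z above height `max A 0 + 1`, hence inside the
  -- half-plane and above height A.
  refine ⟨max A 0 + 2, fun z hz ↦ ?_⟩
  have him (w : ℂ) (hw : w ∈ Metric.closedBall (z : ℂ) 1) : max A 0 + 1 ≤ w.im := by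
    have h1 : |(w - z).im| ≤ 1 := (Complex.abs_im_le_norm _).trans (by
      simpa [dist_eq_norm] using hw)
    rw [Complex.sub_im, abs_le] at h1
    have : z.im = (z : ℂ).im := rfl
    linarith [h1.1]
  have hpos (w : ℂ) (hw : w ∈ Metric.closedBall (z : ℂ) 1) : 0 < w.im := by
    linarith [him w hw, le_max_right A 0]
  rw [UpperHalfPlane.mdifferentiable_iff] at hf
  rw [normalizedDerivOfComplex, norm_mul, norm_inv, inv_mul_le_iff₀ h2, mul_comm, ← div_one (ε * _)]
  refine Complex.norm_deriv_le_of_forall_mem_sphere_norm_le one_pos ?_ fun w hw ↦ ?_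
  · refine DifferentiableOn.diffContOnCl ?_
    rw [closure_ball _ one_ne_zero]
    exact hf.mono fun w hw ↦ hpos w hw
  · have hw' := Metric.sphere_subset_closedBall hw
    rw [Function.comp_apply, ofComplex_apply_of_im_pos (hpos w hw')]
    refine h _ ?_
    change A ≤ w.im
    linarith [him w hw', le_max_left A 0]

/-- The Schwarzian expression `D (dlog F) - (dlog F)² / 2`. -/
def schwarz (F : ℍ → ℂ) : ℍ → ℂ :=
  normalizedDerivOfComplex (dlog F) - (2⁻¹ : ℂ) • (dlog F) ^ 2

lemma mdiff_dlog {F : ℍ → ℂ} (hF : MDiff F) (hF0 : ∀ z, F z ≠ 0) : MDiff (dlog F) := by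
  have h := UpperHalfPlane.mdifferentiable_iff.mp (normalizedDerivOfComplex_mdifferentiable hF)
  rw [UpperHalfPlane.mdifferentiable_iff] at hF ⊢
  exact h.div hF fun z _ ↦ hF0 _

/-- The correction r = 2(2πi)⁻¹ c/(cz+d) in `dlog_slash` satisfies Dr = -r²/2; this Riccati equation
is what makes the Schwarzian expression covariant. -/
lemma deriv_inv_denom (g : GL (Fin 2) ℝ) (z : ℍ) :
    normalizedDerivOfComplex
        (fun w : ℍ ↦ 2 * (2 * Real.pi * Complex.I : ℂ)⁻¹ * (g 1 0 / denom g w)) z =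
      -2 * ((2 * Real.pi * Complex.I : ℂ)⁻¹) ^ 2 * (g 1 0 / denom g z) ^ 2 := by
  have h := (hasDerivAt_denom_zpow g (-1) z).const_mul
    (2 * (2 * Real.pi * Complex.I : ℂ)⁻¹ * (g 1 0 : ℂ))
  have h' : HasDerivAt ((fun w : ℍ ↦ 2 * (2 * Real.pi * Complex.I : ℂ)⁻¹ *
      ((g 1 0 : ℂ) / denom g w)) ∘ ofComplex) (2 * (2 * Real.pi * Complex.I : ℂ)⁻¹ * (g 1 0 : ℂ) *
        (((-1 : ℤ) : ℂ) * (g 1 0 : ℂ) * denom g z ^ ((-1 : ℤ) - 1))) (z : ℂ) := by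
    refine h.congr_of_eventuallyEq ?_
    filter_upwards [isOpen_upperHalfPlaneSet.mem_nhds z.2] with w hw
    simp only [Function.comp_apply, ofComplex_apply_of_im_pos hw, zpow_neg_one]
    rw [mul_assoc _ (g 1 0 : ℂ), div_eq_mul_inv]
  rw [normalizedDerivOfComplex, h'.deriv, show (-1 : ℤ) - 1 = -(2 : ℕ) by norm_num, zpow_neg,
    zpow_natCast]
  push_cast
  ring

/-- With r as in `deriv_inv_denom`, `dlog (F|g)` is `dlog F|g` - r, while D(`dlog F|g`) carries the
anomaly -r · `dlog F|g`. The cross terms cancel and Dr = -r²/2 absorbs r²/2. The factor det⁻¹ comes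
from the normalization det^(k-1) of the slash operator. -/
lemma schwarz_slash {F : ℍ → ℂ} (hF : MDiff F) (hF0 : ∀ z, F z ≠ 0) {g : GL (Fin 2) ℝ}
    (hg : 0 < g.val.det) :
    schwarz (F ∣[(2 : ℤ)] g) = ((g.val.det : ℝ) : ℂ)⁻¹ • (schwarz F ∣[(4 : ℤ)] g) := by
  have hd := mdiff_dlog hF hF0
  have hm : MDiff fun z : ℍ ↦ 2 * (2 * Real.pi * Complex.I : ℂ)⁻¹ * (g 1 0 / denom g z) := by
    have := mdifferentiable_denom_zpow g (-1)
    simp only [zpow_neg_one] at this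
    simp only [div_eq_mul_inv]
    exact mdifferentiable_const.mul (mdifferentiable_const.mul this)
  ext z
  have hσ (x) : σ g x = x := by
    simp only [σ, Matrix.GeneralLinearGroup.val_det_apply, hg, if_true]
    rfl
  have hdet : ((g.val.det : ℝ) : ℂ) ≠ 0 := by exact_mod_cast hg.ne'
  have hz := denom_ne_zero g z
  rw [schwarz, dlog_slash hF hF0 hg, normalizedDerivOfComplex_sub _ _ (hd.slash _ _) hm,
    normalizedDerivOfComplex_slash hd hg]
  simp only [Pi.sub_apply, Pi.smul_apply, Pi.pow_apply, deriv_inv_denom, smul_eq_mul,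
    ModularForm.slash_apply, hσ, Matrix.GeneralLinearGroup.val_det_apply, abs_of_pos hg, schwarz]
  have e1 : (((g.val.det : ℝ) : ℂ)) ^ ((2 : ℤ) + 2 - 1) = ((g.val.det : ℝ) : ℂ) ^ 3 := by norm_cast
  have e5 : (((g.val.det : ℝ) : ℂ)) ^ ((4 : ℤ) - 1) = ((g.val.det : ℝ) : ℂ) ^ 3 := by norm_cast
  have e2 : (((g.val.det : ℝ) : ℂ)) ^ ((2 : ℤ) - 1) = ((g.val.det : ℝ) : ℂ) := by norm_num
  have e3 : denom g z ^ (-((2 : ℤ) + 2)) = (denom g z ^ 4)⁻¹ := by rw [zpow_neg]; norm_cast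
  have e6 : denom g z ^ (-(4 : ℤ)) = (denom g z ^ 4)⁻¹ := by rw [zpow_neg]; norm_cast
  have e4 : denom g z ^ (-(2 : ℤ)) = (denom g z ^ 2)⁻¹ := by rw [zpow_neg]; norm_cast
  rw [e1, e2, e3, e4, e5, e6]
  have hpi := Complex.two_pi_I_ne_zero
  generalize (2 * (Real.pi : ℂ) * Complex.I) = κ at *
  field_simp
  push_cast
  ring

lemma mdiff_schwarz {F : ℍ → ℂ} (hF : MDiff F) (hF0 : ∀ z, F z ≠ 0) : MDiff (schwarz F) := by
  have hd := mdiff_dlog hF hF0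
  refine (normalizedDerivOfComplex_mdifferentiable hd).sub ?_
  rw [pow_two]
  exact (mdifferentiable_const (c := (2⁻¹ : ℂ))).mul (hd.mul hd)

lemma tendsto_E2 : Filter.Tendsto EisensteinSeries.E2 atImInfty (nhds 1) := by
  refine tendsto_of_hasSum_qExpansion
    (c := fun m ↦ if m = 0 then 1 else -24 * (ArithmeticFunction.sigma 1 m : ℂ)) fun τ ↦ ?_
  simpa only [Function.Periodic.qParam, Complex.ofReal_one, div_one] using
    EisensteinSeries.hasSum_qExpansion_E2 (z := τ)

lemma tendsto_E₄ : Filter.Tendsto ModularForm.E₄ atImInfty (nhds 1) := by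
  rw [← EisensteinSeries.E_qExpansion_coeff_zero (k := 4) (by norm_num) ⟨2, rfl⟩]
  exact tendsto_of_hasSum_qExpansion (c := fun m ↦ (qExpansion 1 ModularForm.E₄).coeff m) fun τ ↦
    ModularForm.hasSum_qExpansion ModularForm.E₄ one_pos (by simp) τ

lemma tendsto_schwarz_etaFour :
    Filter.Tendsto (schwarz etaFour) atImInfty (nhds (-(1 / 72))) := by
  have hD : Filter.Tendsto (normalizedDerivOfComplex EisensteinSeries.E2) atImInfty (nhds 0) := by
    -- Removing the constant term 1 leaves the derivative unchanged and gives a function that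
    -- vanishes at the cusp.
    have h1 : normalizedDerivOfComplex (EisensteinSeries.E2 - fun _ ↦ (1 : ℂ)) =
        normalizedDerivOfComplex EisensteinSeries.E2 := by
      rw [normalizedDerivOfComplex_sub _ _ E2_mdifferentiable mdifferentiable_const]
      simp
    rw [← h1]
    refine isZeroAtImInfty_deriv (E2_mdifferentiable.sub mdifferentiable_const) ?_
    have := tendsto_E2.sub_const (1 : ℂ)
    rw [sub_self] at this
    exact this
  rw [schwarz, dlog_etaFour, normalizedDerivOfComplex_smul _ _ E2_mdifferentiable]
  have := (hD.const_smul (6⁻¹ : ℂ)).sub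
    (((tendsto_E2.const_smul (6⁻¹ : ℂ)).pow 2).const_smul (2⁻¹ : ℂ))
  have e : (-(1 / 72) : ℂ) = (6⁻¹ : ℂ) • (0 : ℂ) - (2⁻¹ : ℂ) • ((6⁻¹ : ℂ) • (1 : ℂ)) ^ 2 := by
    simp only [smul_eq_mul]
    norm_num
  rw [e]
  exact this

lemma schwarz_etaFour_slash (α : SL(2, ℤ)) : schwarz etaFour ∣[(4 : ℤ)] α = schwarz etaFour := by
  have h := schwarz_slash mdiff_etaFour etaFour_ne_zero (SL_det α)
  rw [schwarz, dlog_etaFour_SL] at h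
  have hdet : (α : GL (Fin 2) ℝ).val.det = 1 := by
    rw [← Matrix.GeneralLinearGroup.val_det_apply]; simp
  rw [hdet, Complex.ofReal_one, inv_one, one_smul] at h
  exact h.symm

/-- `schwarz η⁴` as a modular form of level one. -/
def schwarzForm : ModularForm 𝒮ℒ 4 where
  toFun := schwarz etaFour
  slash_action_eq' := by
    rintro _ ⟨α, rfl⟩
    exact schwarz_etaFour_slash α
  holo' := mdiff_schwarz mdiff_etaFour etaFour_ne_zero
  bdd_at_cusps' := by
    intro c hc
    rw [Subgroup.IsArithmetic.isCusp_iff_isCusp_SL2Z] at hc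
    rw [OnePoint.isBoundedAt_iff_forall_SL2Z hc]
    intro α _
    rw [schwarz_etaFour_slash]
    -- All translates under SL(2, ℤ) coincide, so the limit at i∞ controls every cusp.
    exact tendsto_schwarz_etaFour.isBigO_one ℝ

/-- Ramanujan's formula for the derivative of `E₂`. -/
lemma schwarz_etaFour : schwarz etaFour = (omegaFour : ℍ → ℂ) := by
  -- Level one forms of weight 4 form a line spanned by E₄; comparing limits at the cusp then gives
  -- c = -1/72.
  obtain ⟨c, hc⟩ : ∃ c : ℂ, c • ModularForm.E₄ = schwarzForm :=
    (finrank_eq_one_iff_of_nonzero' ModularForm.E₄ (EisensteinSeries.E_ne_zero _ ⟨2, rfl⟩)).mp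
      (Module.rank_eq_one_iff_finrank_eq_one.mp ModularForm.levelOne_weight_four_rank_one) _
  have hc' : schwarz etaFour = c • (ModularForm.E₄ : ℍ → ℂ) := congrArg DFunLike.coe hc.symm
  have h := tendsto_schwarz_etaFour
  rw [hc'] at h
  have h' := tendsto_nhds_unique h (tendsto_E₄.const_smul c)
  rw [smul_eq_mul, mul_one] at h'
  rw [hc', ← h']
  rfl

/-! Compatibility of the operators with the slash action. -/

lemma slash_two (γ : GL(2, ℚ)⁺) (f : ℍ → ℂ) : slash 2 γ f = f ∣[(2 : ℤ)] toReal γ := by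
  rw [slash_eq]; norm_num

lemma deriv_slash {k : ℕ} {f : ℍ → ℂ} (hf : MDiff f) (γ : GL(2, ℚ)⁺) :
    normalizedDerivOfComplex (slash k γ f) = slash (k + 2) γ (normalizedDerivOfComplex f) -
      fun z : ℍ ↦ (k : ℂ) * (2 * Real.pi * Complex.I : ℂ)⁻¹ *
        (toReal γ 1 0 / denom (toReal γ) z) * slash k γ f z := by
  have hd := toReal_det_pos γ
  have hdC : (((toReal γ).val.det : ℝ) : ℂ) ≠ 0 := by exact_mod_cast hd.ne'
  -- Passing from det^(k-1) to the normalization det^(k/2) absorbs the factor det⁻¹ produced by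
  -- differentiating the slash.
  have e : (toReal γ).val.det ^ (1 - ((k + 2 : ℕ) : ℝ) / 2) =
      (toReal γ).val.det ^ (1 - (k : ℝ) / 2) * (toReal γ).val.det⁻¹ := by
    rw [← Real.rpow_neg_one, ← Real.rpow_add hd]
    congr 1
    push_cast
    ring
  rw [slash_eq k, slash_eq (k + 2), e, normalizedDerivOfComplex_smul _ _ (hf.slash _ _),
    normalizedDerivOfComplex_slash hf hd]
  ext z
  simp only [Pi.sub_apply, Pi.smul_apply, smul_eq_mul]
  push_cast
  ring

/-- Both `D` and φ have anomalies under γ, and together they leave exactly μ_γ times k/2. This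
failure of X to commute with the slash action is the origin of the term δ₁ ⊗ Y in ΔX. -/
lemma ramanujan_slash {k : ℕ} {f : ℍ → ℂ} (hf : MDiff f) (γ : GL(2, ℚ)⁺) :
    ramanujan k (slash k γ f) =
      slash (k + 2) γ (ramanujan k f) + muFun γ * (((k : ℂ) / 2) • slash k γ f) := by
  have h1 : slash (k + 2) γ (dlog etaFour * ((k : ℂ) / 2) • f) =
      slash 2 γ (dlog etaFour) * (((k : ℂ) / 2) • slash k γ f) := by
    rw [add_comm, slash_mul_fun, slash_smul]
  have h2 : ramanujan k f = normalizedDerivOfComplex f +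
      (-1 : ℂ) • (dlog etaFour * ((k : ℂ) / 2) • f) := by
    ext z; simp [ramanujan]; ring
  rw [h2, slash_add, slash_smul, h1, muFun_eq,
    dlog_slash mdiff_etaFour etaFour_ne_zero (toReal_det_pos γ), slash_two]
  ext z
  simp only [ramanujan, deriv_slash hf, Pi.add_apply, Pi.mul_apply, Pi.sub_apply, Pi.smul_apply,
    smul_eq_mul]
  ring

lemma XM_slashM (γ : GL(2, ℚ)⁺) (a : ModForms) :
    XM (slashM γ a) = slashM γ (XM a) + incl 2 (mu γ) * YM (slashM γ a) := by
  induction a using modForms_induction with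
  | h0 => simp
  | h2 a b ha hb => simp only [map_add, ha, hb, mul_add]; abel
  | h1 k f =>
    have h : IsModular (k + 2) (muFun γ * (((k : ℂ) / 2) • slash k γ f)) := by
      rw [add_comm]
      exact IsModular.mul (mu γ).2 (IsModular.smul _ (IsModular.slash f.2 γ))
    have e : incl 2 (mu γ) * incl k (((k : ℂ) / 2) • slashLin k γ f) = incl (k + 2) ⟨_, h⟩ := by
      rw [incl_mul]
      exact incl_congr (add_comm 2 k) _ _ rfl
    rw [slashM_incl, XM_incl, XM_incl, YM_incl, slashM_incl, ← map_smul, e, ← map_add]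
    congr 1
    exact Subtype.ext (ramanujan_slash (IsModular.mdiff f.2) γ)

lemma YM_slashM (γ : GL(2, ℚ)⁺) (a : ModForms) : YM (slashM γ a) = slashM γ (YM a) := by
  induction a using modForms_induction with
  | h0 => simp
  | h2 a b ha hb => simp only [map_add, ha, hb]
  | h1 k f => simp

lemma slashM_slashM (α β : GL(2, ℚ)⁺) (a : ModForms) :
    slashM α (slashM β a) = slashM (β * α) a :=
  (mul_smul (MulOpposite.op α) (MulOpposite.op β) a).symm

lemma slashM_one_left (a : ModForms) : slashM 1 a = a :=
  one_smul (GL(2, ℚ)⁺)ᵐᵒᵖ a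

/-- Both sides telescope through η⁴|βα: the terms c/(cz+d) in the two uses of `dlog_slash` at α are
the same and cancel. -/
lemma muFun_mul (α β : GL(2, ℚ)⁺) : muFun (β * α) = muFun α + slash 2 α (muFun β) := by
  simp only [muFun_eq, slash_two, map_mul, SlashAction.slash_mul]
  rw [dlog_slash (mdiff_etaFour.slash _ _) (slash_ne_zero etaFour_ne_zero (toReal_det_pos β))
      (toReal_det_pos α), sub_eq_add_neg (dlog (etaFour ∣[(2 : ℤ)] toReal β)),
    SlashAction.add_slash, SlashAction.neg_slash,
    dlog_slash mdiff_etaFour etaFour_ne_zero (toReal_det_pos α)]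
  abel

lemma incl_mu_mul (α β : GL(2, ℚ)⁺) :
    incl 2 (mu (β * α)) = incl 2 (mu α) + slashM α (incl 2 (mu β)) := by
  rw [slashM_incl, ← map_add]
  congr 1
  exact Subtype.ext (muFun_mul α β)

lemma incl_mu_one : incl 2 (mu 1) = 0 := by
  have := incl_mu_mul 1 1
  rw [mul_one, slashM_one_left, eq_comm, add_eq_left] at this
  exact this

/-- The square of a form of weight two. -/
def sqForm (m : M 2) : M 4 := ⟨m * m, IsModular.mul m.2 m.2⟩

lemma incl_sq (m : M 2) : incl 2 m ^ 2 = incl 4 (sqForm m) := by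
  rw [pow_two, incl_mul]; rfl

/-- `X` in weight two. -/
def XTwo (m : M 2) : M 4 := XLin 2 m

lemma XM_incl_two (m : M 2) : XM (incl 2 m) = incl 4 (XTwo m) := XM_incl 2 m

lemma incl_injective (k : ℕ) : Function.Injective (incl k) :=
  DirectSum.of_injective (β := fun k ↦ M k) k

lemma ramanujan_two (f : ℍ → ℂ) (z : ℍ) :
    ramanujan 2 f z = normalizedDerivOfComplex f z - dlog etaFour z * f z := by
  simp [ramanujan]

/-- The coboundary `ω₄` of the Schwarzian cocycle. -/
lemma XM_mu (γ : GL(2, ℚ)⁺) :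
    XM (incl 2 (mu γ)) - (1 / 2 : ℂ) • incl 2 (mu γ) ^ 2 =
      slashM γ (incl 4 omegaFour) - incl 4 omegaFour := by
  rw [incl_sq, XM_incl_two, slashM_incl, ← map_smul, ← map_sub, ← map_sub]
  congr 1
  refine Subtype.ext ?_
  change ramanujan 2 (muFun γ) - (1 / 2 : ℂ) • (muFun γ * muFun γ) =
    slash 4 γ omegaFour - (omegaFour : ℍ → ℂ)
  have h := schwarz_slash mdiff_etaFour etaFour_ne_zero (toReal_det_pos γ)
  have hs : slash 4 γ omegaFour = schwarz (etaFour ∣[(2 : ℤ)] toReal γ) := by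
    rw [h, ← schwarz_etaFour, slash_eq]
    congr 1
    rw [← Complex.ofReal_inv]
    norm_num [Real.rpow_neg_one]
  rw [hs, ← schwarz_etaFour]
  -- In weight two X is D - φ. With φ_γ = `dlog (η⁴|γ)` and μ_γ = φ_γ - φ, the left side expands to
  -- (Dφ_γ - φ_γ²/2) - (Dφ - φ²/2).
  ext z
  simp only [Pi.sub_apply, Pi.smul_apply, Pi.mul_apply, ramanujan_two, schwarz, muFun_eq,
    Pi.pow_apply, smul_eq_mul]
  rw [normalizedDerivOfComplex_sub _ _ (mdiff_dlog (mdiff_etaFour.slash _ _)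
    (slash_ne_zero etaFour_ne_zero (toReal_det_pos γ)))
    (mdiff_dlog mdiff_etaFour etaFour_ne_zero)]
  simp only [Pi.sub_apply]
  ring

/-! The equation `X(m) + m² / 2 = ω₄`. -/

/-- A periodic solution of the Riccati equation `F' = πi F²` on the upper half-plane vanishes. -/
lemma eq_zero_of_riccati {F : ℂ → ℂ} (hF : DifferentiableOn ℂ F upperHalfPlaneSet)
    (hd : ∀ z ∈ upperHalfPlaneSet, deriv F z = Real.pi * Complex.I * F z ^ 2) {N : ℝ} (hN : N ≠ 0)
    (hper : ∀ z ∈ upperHalfPlaneSet, F (z + N) = F z) : ∀ z ∈ upperHalfPlaneSet, F z = 0 := by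
  intro z₁ hz₁
  by_contra h0
  have hopen := isOpen_upperHalfPlaneSet
  have hconn : IsPreconnected upperHalfPlaneSet := (convex_halfSpace_im_gt 0).isPreconnected
  have hat (z) (hz : z ∈ upperHalfPlaneSet) : DifferentiableAt ℂ F z :=
    (hF z hz).differentiableAt (hopen.mem_nhds hz)
  -- Where F ≠ 0 the equation says (1/F)' = -πi, so 1/F + πi z is locally constant, with value b
  -- near z₁.
  set b : ℂ := (F z₁)⁻¹ + Real.pi * Complex.I * z₁ with hb
  obtain ⟨r, hr, hball⟩ : ∃ r > 0, Metric.ball z₁ r ⊆ {z | z ∈ upperHalfPlaneSet ∧ F z ≠ 0} := by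
    refine Metric.mem_nhds_iff.mp ?_
    filter_upwards [hopen.mem_nhds hz₁, (hat z₁ hz₁).continuousAt.eventually_ne h0] with z h h'
      using ⟨h, h'⟩
  have hder (z) (hz : z ∈ Metric.ball z₁ r) :
      HasDerivAt (fun w ↦ (F w)⁻¹ + Real.pi * Complex.I * w) 0 z := by
    have h := hball hz
    have h1 := ((hat z h.1).hasDerivAt.inv h.2).add
      ((hasDerivAt_id z).const_mul (Real.pi * Complex.I : ℂ))
    rw [hd z h.1] at h1
    have h2 := h.2
    refine h1.congr_deriv ?_
    field_simp
    ring
  have hconst (z) (hz : z ∈ Metric.ball z₁ r) : (F z)⁻¹ + Real.pi * Complex.I * z = b :=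
    Metric.isOpen_ball.is_const_of_deriv_eq_zero (convex_ball z₁ r).isPreconnected
      (fun z hz ↦ (hder z hz).differentiableAt.differentiableWithinAt)
      (fun z hz ↦ (hder z hz).deriv) hz (Metric.mem_ball_self hr)
  have hg : DifferentiableOn ℂ (fun z ↦ F z * (b - Real.pi * Complex.I * z)) upperHalfPlaneSet :=
    hF.mul (by fun_prop)
  -- The product form avoids dividing by F, so the identity theorem extends it to the whole
  -- half-plane. Its values at z₁ and z₁ + N, where F agrees by periodicity, then contradict each
  -- other.
  have hone : Set.EqOn (fun z ↦ F z * (b - Real.pi * Complex.I * z)) (fun _ ↦ 1)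
      upperHalfPlaneSet := by
    refine (hg.analyticOnNhd hopen).eqOn_of_preconnected_of_eventuallyEq
      (analyticOnNhd_const) hconn hz₁ ?_
    filter_upwards [Metric.ball_mem_nhds z₁ hr] with z hz
    rw [← hconst z hz, add_sub_cancel_right, mul_inv_cancel₀ (hball hz).2]
  have h1 := hone hz₁
  have hz₂ : z₁ + N ∈ upperHalfPlaneSet := by
    simpa [upperHalfPlaneSet] using hz₁
  have h2 := hone hz₂
  simp only [hper z₁ hz₁] at h1 h2
  have h3 : F z₁ * (Real.pi * Complex.I * N) = 0 := by linear_combination h1 - h2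
  have hpi : (Real.pi : ℂ) ≠ 0 := by exact_mod_cast Real.pi_ne_zero
  have hN' : (N : ℂ) ≠ 0 := by exact_mod_cast hN
  exact mul_ne_zero h0 (mul_ne_zero (mul_ne_zero hpi Complex.I_ne_zero) hN') h3

/-- This is the quasimodularity of φ = E₂/6; the term in c/(cz+d) is what no modular form can
cancel. -/
lemma dlog_etaFour_slash (α : SL(2, ℤ)) (z : ℍ) : (dlog etaFour ∣[(2 : ℤ)] α) z =
    dlog etaFour z + 2 * (2 * Real.pi * Complex.I : ℂ)⁻¹ * ((α 1 0 : ℤ) / denom α z) := by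
  have h := congrFun (dlog_slash mdiff_etaFour etaFour_ne_zero (SL_det α)) z
  rw [dlog_etaFour_SL] at h
  rw [h]
  simp [ModularForm.SL_slash]

/-- No form `m` of weight two satisfies `X(m) + m² / 2 = ω₄`. -/
theorem no_solution (m : M 2) :
    XM (incl 2 m) + (1 / 2 : ℂ) • incl 2 m ^ 2 ≠ incl 4 omegaFour := by
  intro h
  rw [incl_sq, XM_incl_two, ← map_smul, ← map_add] at h
  have heq : ramanujan 2 m + (1 / 2 : ℂ) • ((m : ℍ → ℂ) * m) = schwarz etaFour := by
    rw [schwarz_etaFour]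
    exact congrArg Subtype.val (incl_injective 4 h)
  obtain ⟨hm, ⟨N, hN, hinv⟩, -⟩ := (isModular_iff 2 m).mp m.2
  push_cast at hinv
  have hφ := mdiff_dlog mdiff_etaFour etaFour_ne_zero
  -- Since m is invariant under Γ(N), ψ keeps the anomaly of φ there.
  set ψ : ℍ → ℂ := dlog etaFour - m with hψ
  have hψd : MDiff ψ := hφ.sub hm
  have hslash (α) (hα : α ∈ Γ(N)) (z : ℍ) : (ψ ∣[(2 : ℤ)] α) z =
      ψ z + 2 * (2 * Real.pi * Complex.I : ℂ)⁻¹ * ((α 1 0 : ℤ) / denom α z) := by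
    rw [hψ, sub_eq_add_neg, SlashAction.add_slash, SlashAction.neg_slash, hinv α hα,
      Pi.add_apply, dlog_etaFour_slash]
    simp only [Pi.add_apply, Pi.neg_apply]
    ring
  -- From Dm - φm + m²/2 = Dφ - φ²/2 by completing the square.
  have hD (z : ℍ) : normalizedDerivOfComplex ψ z = 2⁻¹ * ψ z ^ 2 := by
    have := congrFun heq z
    simp only [Pi.add_apply, Pi.smul_apply, Pi.mul_apply, ramanujan_two, schwarz, Pi.sub_apply,
      Pi.pow_apply, smul_eq_mul] at this
    rw [hψ, normalizedDerivOfComplex_sub _ _ hφ hm]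
    simp only [Pi.sub_apply]
    linear_combination -this
  have hzero : ∀ z ∈ upperHalfPlaneSet, (ψ ∘ ofComplex) z = 0 := by
    refine eq_zero_of_riccati (N := N) (UpperHalfPlane.mdifferentiable_iff.mp hψd) (fun z hz ↦ ?_)
      (by exact_mod_cast hN) fun z hz ↦ ?_
    · have := hD ⟨z, hz⟩
      rw [normalizedDerivOfComplex, inv_mul_eq_iff_eq_mul₀ Complex.two_pi_I_ne_zero] at this
      rw [Function.comp_apply, ofComplex_apply_of_im_pos hz, this]
      ring
    -- For this translation c = 0, so the anomaly vanishes and ψ has period N.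
    · let α : SL(2, ℤ) := ⟨!![1, N; 0, 1], by simp⟩
      have hα : α ∈ Γ(N) := by
        rw [CongruenceSubgroup.Gamma_mem]; simp [α]
      have := hslash α hα ⟨z, hz⟩
      have hz' : 0 < (z + (N : ℝ)).im := by simpa using hz
      rw [Function.comp_apply, Function.comp_apply, ofComplex_apply_of_im_pos hz,
        ofComplex_apply_of_im_pos hz']
      rw [ModularForm.SL_slash_apply] at this
      have hsm : α • (⟨z, hz⟩ : ℍ) = ⟨z + (N : ℝ), hz'⟩ := by
        ext
        rw [UpperHalfPlane.specialLinearGroup_apply]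
        simp [α]
      rw [hsm, ModularGroup.denom_apply] at this
      simpa [α] using this
  -- Here c = N ≠ 0, so the anomaly is nonzero although ψ vanishes identically.
  let α : SL(2, ℤ) := ⟨!![1, 0; N, 1], by simp⟩
  have hα : α ∈ Γ(N) := by
    rw [CongruenceSubgroup.Gamma_mem]; simp [α]
  have hψ0 : ψ = 0 := by
    ext z
    simpa using hzero z z.2
  have := hslash α hα UpperHalfPlane.I
  rw [hψ0, SlashAction.zero_slash] at this
  have hden := denom_ne_zero (α : GL (Fin 2) ℝ) UpperHalfPlane.I
  rw [Pi.zero_apply, zero_add, eq_comm] at this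
  refine mul_ne_zero (mul_ne_zero two_ne_zero (inv_ne_zero Complex.two_pi_I_ne_zero))
    (div_ne_zero ?_ hden) this
  simpa [α] using hN

/-! Forms invariant under `GL⁺(2, ℚ)`. -/

/-- Upper triangular elements of `GL⁺(2, ℚ)` with second diagonal entry `1`. -/
def upper (a b : ℚ) (ha : 0 < a) : GL(2, ℚ)⁺ :=
  ⟨Matrix.GeneralLinearGroup.mkOfDetNeZero !![a, b; 0, 1] (by simpa using ha.ne'), by
    rw [Matrix.mem_glpos]
    simpa [Matrix.GeneralLinearGroup.mkOfDetNeZero] using ha⟩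

lemma slash_upper (k : ℕ) (a b : ℚ) (ha : 0 < a) (f : ℍ → ℂ) (z : ℂ) (hz : 0 < z.im)
    (hz' : 0 < ((a : ℂ) * z + b).im) :
    slash k (upper a b ha) f ⟨z, hz⟩ =
      (((a : ℝ) ^ ((k : ℝ) / 2) : ℝ) : ℂ) * f ⟨a * z + b, hz'⟩ := by
  have h1 : (toReal (upper a b ha)).val.det = a := by
    simp [toReal, upper, Matrix.det_fin_two, Matrix.GeneralLinearGroup.mkOfDetNeZero]
  have h2 : denom (toReal (upper a b ha)) z = 1 := by
    simp [toReal, upper, denom, Matrix.GeneralLinearGroup.mkOfDetNeZero]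
  have h3 : toReal (upper a b ha) • (⟨z, hz⟩ : ℍ) = ⟨a * z + b, hz'⟩ := by
    ext
    rw [UpperHalfPlane.coe_smul_of_det_pos (by
      rw [Matrix.GeneralLinearGroup.val_det_apply]; exact toReal_det_pos _)]
    simp [num, denom, toReal, upper, Matrix.GeneralLinearGroup.mkOfDetNeZero]
  simp [slash, h1, h2, h3]

/-- Invariance under arbitrarily small rational translations forces f' = 0, so f is constant; the
dilation z ↦ 2z then multiplies this constant by 2^(k/2) ≠ 1. -/
lemma eq_zero_of_slash_invariant {k : ℕ} (hk : k ≠ 0) {f : ℍ → ℂ} (hf : MDiff f)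
    (h : ∀ γ, slash k γ f = f) : f = 0 := by
  have hopen := isOpen_upperHalfPlaneSet
  have hF := UpperHalfPlane.mdifferentiable_iff.mp hf
  have htrans (z : ℂ) (hz : z ∈ upperHalfPlaneSet) (r : ℚ) :
      (f ∘ ofComplex) (z + r) = (f ∘ ofComplex) z := by
    have hz' : 0 < (((1 : ℚ) : ℂ) * z + r).im := by simpa using hz
    have := congrFun (h (upper 1 r one_pos)) ⟨z, hz⟩
    rw [slash_upper k 1 r one_pos f z hz hz'] at this
    simp only [Rat.cast_one, one_mul] at hz'
    rw [Function.comp_apply, Function.comp_apply, ofComplex_apply_of_im_pos hz,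
      ofComplex_apply_of_im_pos hz', ← this]
    simp
  have hderiv (z : ℂ) (hz : z ∈ upperHalfPlaneSet) : deriv (f ∘ ofComplex) z = 0 := by
    have h1 := ((hF z hz).differentiableAt (hopen.mem_nhds hz)).hasDerivAt.tendsto_slope_zero
    -- The derivative exists, so it may be computed along the rational increments 1/(n+1), where
    -- every difference quotient is zero.
    have h2 : Filter.Tendsto (fun n : ℕ ↦ ((1 / ((n : ℚ) + 1) : ℚ) : ℂ)) Filter.atTop
        (nhdsWithin 0 {0}ᶜ) := by
      refine tendsto_nhdsWithin_iff.mpr ⟨?_, Filter.Eventually.of_forall fun n ↦ ?_⟩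
      · have := tendsto_one_div_add_atTop_nhds_zero_nat (𝕜 := ℂ)
        simpa using this
      · have : (n : ℂ) + 1 ≠ 0 := by exact_mod_cast n.succ_ne_zero
        simpa using this
    refine tendsto_nhds_unique (h1.comp h2) ?_
    refine tendsto_const_nhds.congr fun n ↦ ?_
    simp only [Function.comp_apply] at htrans ⊢
    rw [htrans z hz, sub_self, smul_zero]
  have hconst (z w : ℂ) (hz : z ∈ upperHalfPlaneSet) (hw : w ∈ upperHalfPlaneSet) :
      (f ∘ ofComplex) z = (f ∘ ofComplex) w :=
    hopen.is_const_of_deriv_eq_zero (convex_halfSpace_im_gt 0).isPreconnected hF hderiv hz hw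
  ext ⟨z, hz⟩
  have hz' : 0 < (((2 : ℚ) : ℂ) * z + ((0 : ℚ) : ℂ)).im := by simpa using hz
  have h2 := congrFun (h (upper 2 0 two_pos)) ⟨z, hz⟩
  rw [slash_upper k 2 0 two_pos f z hz hz'] at h2
  have h3 := hconst _ _ hz' hz
  rw [Function.comp_apply, Function.comp_apply, ofComplex_apply_of_im_pos hz,
    ofComplex_apply_of_im_pos hz'] at h3
  rw [h3] at h2
  have h4 : (1 : ℝ) < ((2 : ℚ) : ℝ) ^ ((k : ℝ) / 2) :=
    Real.one_lt_rpow (by norm_num) (by positivity)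
  by_contra h0
  have := mul_right_cancel₀ h0 (h2.trans (one_mul _).symm)
  exact h4.ne' (by exact_mod_cast this)

/-! Representations of `H₁` on the crossed product by diagonal operators. -/

/-- Coefficients of a representation of `H₁` by diagonal operators: on the component of `U_γ^*`,
`X` acts as `X + A_γ + m Y`, `Y` as `Y + c`, and `δ₁` as multiplication by `p_γ`. -/
structure DiagRep where
  /-- The potential of `X`. -/
  A : GL(2, ℚ)⁺ → ModForms
  /-- The coefficient of `Y` in the operator of `X`. -/
  m : ModForms
  /-- The shift of `Y`. -/
  c : ℂ
  /-- The symbol of `δ₁`. -/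
  p : GL(2, ℚ)⁺ → ModForms
  -- `YM` is half the weight, so these three conditions say that the coefficients have weight two,
  -- as [Y, X] = X and [Y, δ₁] = δ₁ require.
  YM_A : ∀ γ, YM (A γ) = A γ
  YM_m : YM m = m
  YM_p : ∀ γ, YM (p γ) = p γ

namespace DiagRep

variable (R : DiagRep)

/-- The symbol of `δ_{n+1}`. -/
def symbol (γ : GL(2, ℚ)⁺) : ℕ → ModForms
  | 0 => R.p γ
  | n + 1 => XM (symbol γ n) + R.m * YM (symbol γ n)

lemma YM_symbol (γ : GL(2, ℚ)⁺) (n : ℕ) :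
    YM (R.symbol γ n) = ((n : ℂ) + 1) • R.symbol γ n := by
  induction n with
  | zero => simp [symbol, R.YM_p]
  | succ n ih =>
    simp only [symbol, map_add, YM_XM, YM_mul, R.YM_m, ih, map_smul, mul_smul_comm]
    push_cast
    module

/-- The operator of `X`. -/
def opX : Module.End ℂ Crossed :=
  diagonal fun γ ↦ XM + LinearMap.mulLeft ℂ (R.A γ) + LinearMap.mulLeft ℂ R.m ∘ₗ YM

/-- The operator of `Y`. -/
def opY : Module.End ℂ Crossed := diagonal fun _ ↦ YM + R.c • LinearMap.id

/-- The operator of `δ_{n+1}`. -/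
def opD (n : ℕ) : Module.End ℂ Crossed := diagonal fun γ ↦ LinearMap.mulLeft ℂ (R.symbol γ n)

lemma opY_opX : R.opY * R.opX - R.opX * R.opY = R.opX := by
  simp only [opX, opY, diagonal_mul, diagonal_sub]
  congr 1
  ext γ a : 2
  simp only [LinearMap.sub_apply, LinearMap.comp_apply, LinearMap.add_apply, LinearMap.smul_apply,
    LinearMap.id_apply, LinearMap.mulLeft_apply, map_add, map_smul, YM_XM, YM_mul, R.YM_A, R.YM_m,
    smul_add]
  abel

lemma opY_opD (n : ℕ) : R.opY * R.opD n - R.opD n * R.opY = ((n : ℂ) + 1) • R.opD n := by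
  simp only [opD, opY, diagonal_mul, diagonal_sub, diagonal_smul]
  congr 1
  ext γ a : 2
  simp only [LinearMap.sub_apply, LinearMap.comp_apply, LinearMap.add_apply, LinearMap.smul_apply,
    LinearMap.id_apply, LinearMap.mulLeft_apply, YM_mul, R.YM_symbol, mul_add, mul_smul_comm,
    smul_mul_assoc]
  abel

/-- X and m Y are derivations in the form, and A_γ commutes with multiplications. The commutator
with multiplication by s is therefore multiplication by X(s) + m Y(s), which is the recursion
defining `symbol`. -/
lemma opX_opD (n : ℕ) : R.opX * R.opD n - R.opD n * R.opX = R.opD (n + 1) := by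
  simp only [opD, opX, diagonal_mul, diagonal_sub]
  congr 1
  ext γ a : 2
  simp only [LinearMap.sub_apply, LinearMap.comp_apply, LinearMap.add_apply,
    LinearMap.mulLeft_apply, XM_mul, YM_mul, symbol]
  ring

lemma opD_opD (k l : ℕ) : R.opD k * R.opD l = R.opD l * R.opD k := by
  simp only [opD, diagonal_mul]
  congr 1
  ext γ a : 2
  simp [mul_left_comm]

/-- The representation of `H₁`. -/
def rep : H1 →ₐ[ℂ] Module.End ℂ Crossed :=
  H1.lift R.opX R.opY R.opD R.opY_opX R.opY_opD R.opX_opD R.opD_opD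

lemma rep_X : R.rep H1.X = R.opX := H1.lift_gen _ _ _ _ _ _ _ Gen.X

lemma rep_Y : R.rep H1.Y = R.opY := H1.lift_gen _ _ _ _ _ _ _ Gen.Y

lemma rep_d (n : ℕ) : R.rep (H1.d n) = R.opD n := H1.lift_gen _ _ _ _ _ _ _ (Gen.d n)

lemma rep_X_U (γ : GL(2, ℚ)⁺) (f : ModForms) :
    R.rep H1.X (U γ f) = U γ (XM f + R.A γ * f + R.m * YM f) := by
  rw [rep_X, opX, diagonal_U]; rfl

lemma rep_Y_U (γ : GL(2, ℚ)⁺) (f : ModForms) :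
    R.rep H1.Y (U γ f) = U γ (YM f + R.c • f) := by
  rw [rep_Y, opY, diagonal_U]; rfl

lemma rep_d_U (n : ℕ) (γ : GL(2, ℚ)⁺) (f : ModForms) :
    R.rep (H1.d n) (U γ f) = U γ (R.symbol γ n * f) := by
  rw [rep_d, opD, diagonal_U]; rfl

/-- The linear map `h ↦ h(a)`. -/
def orbit (a : Crossed) : Conv := WithConv.toConv (R.rep.toLinearMap.flip a)

end DiagRep

/-! ### Leibniz rules between diagonal representations -/

/-- The evaluation of `s ∈ H₁ ⊗ H₁` on `a` and `b` through two representations, followed by the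
product. -/
def evalTensor (Q R : DiagRep) (a b : Crossed) : H1 ⊗[ℂ] H1 →ₗ[ℂ] Crossed :=
  LinearMap.mul' ℂ Crossed ∘ₗ TensorProduct.map (Q.rep.toLinearMap.flip a)
    (R.rep.toLinearMap.flip b)

@[simp] lemma evalTensor_tmul (Q R : DiagRep) (a b : Crossed) (x y : H1) :
    evalTensor Q R a b (x ⊗ₜ y) = Q.rep x a * R.rep y b := rfl

lemma evalTensor_mul_tmul (Q R : DiagRep) (a b : Crossed) (s : H1 ⊗[ℂ] H1) (x y : H1) :
    evalTensor Q R a b (s * x ⊗ₜ y) = evalTensor Q R (Q.rep x a) (R.rep y b) s := by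
  induction s with
  | zero => simp
  | add s s' h h' => rw [add_mul, map_add, h, h', map_add]
  | tmul z w => simp [Module.End.mul_apply]

lemma orbit_mul_orbit (Q R : DiagRep) (a b : Crossed) (h : H1) :
    (Q.orbit a * R.orbit b) h = evalTensor Q R a b (H1.comulHom h) := rfl

/-- If a Leibniz rule holds on the generators, it holds on all of `H₁`. -/
lemma leibniz_of_generators (P Q R : DiagRep)
    (hX : ∀ a b, P.rep H1.X (a * b) =
      Q.rep H1.X a * b + a * R.rep H1.X b + Q.rep (H1.d 0) a * R.rep H1.Y b)
    (hY : ∀ a b, P.rep H1.Y (a * b) = Q.rep H1.Y a * b + a * R.rep H1.Y b)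
    (hd : ∀ a b, P.rep (H1.d 0) (a * b) = Q.rep (H1.d 0) a * b + a * R.rep (H1.d 0) b)
    (h : H1) (a b : Crossed) : (Q.orbit a * R.orbit b) h = P.rep h (a * b) := by
  rw [orbit_mul_orbit]
  revert a b
  refine H1.gen_induction
    { carrier := {h | ∀ a b, evalTensor Q R a b (H1.comulHom h) = P.rep h (a * b)}
      mul_mem' := fun {h h'} ih ih' a b ↦ by
        -- The rule for h is needed for all pairs of arguments: multiplying Δ(h') by Δ(h) applies
        -- the rule for h to each pure tensor occurring in Δ(h').
        have key (s : H1 ⊗[ℂ] H1) : evalTensor Q R a b (H1.comulHom h * s) =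
            P.rep h (evalTensor Q R a b s) := by
          induction s with
          | zero => simp
          | add s s' e e' => rw [mul_add, map_add, e, e', map_add, map_add]
          | tmul x y => rw [evalTensor_mul_tmul, evalTensor_tmul]; exact ih _ _
        rw [map_mul, key, ih', map_mul P.rep, Module.End.mul_apply]
      add_mem' := fun {h h'} ih ih' a b ↦ by
        rw [map_add, map_add, ih, ih', map_add, LinearMap.add_apply]
      algebraMap_mem' := fun c a b ↦ by
        rw [AlgHom.commutes, AlgHom.commutes, Algebra.algebraMap_eq_smul_one,
          Algebra.TensorProduct.one_def, map_smul, evalTensor_tmul]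
        simp [Algebra.algebraMap_eq_smul_one] } ?_ ?_ ?_ h
  · intro a b
    simp [hX, H1.comulX]
  · intro a b
    simp [hY, H1.comulY]
  · intro a b
    simp [hd, H1.comulD]

lemma bilin_ext {φ ψ : Crossed →ₗ[ℂ] Crossed →ₗ[ℂ] Crossed}
    (h : ∀ α β f g, φ (U α f) (U β g) = ψ (U α f) (U β g)) (a b : Crossed) : φ a b = ψ a b := by
  have : φ = ψ := crossed_ext fun α f ↦ crossed_ext fun β g ↦ h α β f g
  rw [this]

/-- A Leibniz rule for three representations with compatible coefficients. -/
lemma leibniz (P Q R : DiagRep) (hc : P.c = Q.c + R.c) (hm : P.m = Q.m)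
    (hA : ∀ α β, P.A (β * α) = Q.A α + slashM α (R.A β) + R.c • Q.p α)
    (hp : ∀ α β, P.p (β * α) = Q.p α + slashM α (R.p β))
    (hmu : ∀ α, incl 2 (mu α) + P.m = slashM α R.m + Q.p α)
    (h : H1) (a b : Crossed) : (Q.orbit a * R.orbit b) h = P.rep h (a * b) := by
  refine leibniz_of_generators P Q R (fun a b ↦ ?_) (fun a b ↦ ?_) (fun a b ↦ ?_) h a b
  · refine bilin_ext (φ := (LinearMap.mul ℂ Crossed).compr₂ (P.rep H1.X))
      (ψ := (LinearMap.mul ℂ Crossed).compl₁₂ (Q.rep H1.X) LinearMap.id +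
        (LinearMap.mul ℂ Crossed).compl₁₂ LinearMap.id (R.rep H1.X) +
        (LinearMap.mul ℂ Crossed).compl₁₂ (Q.rep (H1.d 0)) (R.rep H1.Y))
      (fun α β f g ↦ ?_) a b
    simp only [LinearMap.compr₂_apply, LinearMap.add_apply, LinearMap.compl₁₂_apply,
      LinearMap.mul_apply', LinearMap.id_apply, DiagRep.rep_X_U, DiagRep.rep_Y_U, DiagRep.rep_d_U,
      U_mul_U, ← map_add]
    congr 1
    -- On f U_α^* · g U_β^* the hypotheses match coefficients: `hA` that of f (g|α), `hm` that of
    -- Y(f) (g|α), and `hmu` that of f (Yg|α), where μ_α enters through X(g|α).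
    have h1 := hmu α
    have h2 := hA α β
    simp only [DiagRep.symbol, XM_mul, YM_mul, XM_slashM, YM_slashM, map_add, map_smul,
      slashM_mul] at h1 h2 ⊢
    simp only [Algebra.smul_def] at h2 ⊢
    rw [h2, ← hm]
    linear_combination (f * slashM α (YM g)) * h1
  · refine bilin_ext (φ := (LinearMap.mul ℂ Crossed).compr₂ (P.rep H1.Y))
      (ψ := (LinearMap.mul ℂ Crossed).compl₁₂ (Q.rep H1.Y) LinearMap.id +
        (LinearMap.mul ℂ Crossed).compl₁₂ LinearMap.id (R.rep H1.Y))
      (fun α β f g ↦ ?_) a b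
    simp only [LinearMap.compr₂_apply, LinearMap.add_apply, LinearMap.compl₁₂_apply,
      LinearMap.mul_apply', LinearMap.id_apply, DiagRep.rep_Y_U, U_mul_U, ← map_add]
    congr 1
    simp only [YM_mul, YM_slashM, map_add, map_smul, hc]
    simp only [Algebra.smul_def, map_add]
    ring
  · refine bilin_ext (φ := (LinearMap.mul ℂ Crossed).compr₂ (P.rep (H1.d 0)))
      (ψ := (LinearMap.mul ℂ Crossed).compl₁₂ (Q.rep (H1.d 0)) LinearMap.id +
        (LinearMap.mul ℂ Crossed).compl₁₂ LinearMap.id (R.rep (H1.d 0)))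
      (fun α β f g ↦ ?_) a b
    simp only [LinearMap.compr₂_apply, LinearMap.add_apply, LinearMap.compl₁₂_apply,
      LinearMap.mul_apply', LinearMap.id_apply, DiagRep.rep_d_U, U_mul_U, ← map_add]
    congr 1
    simp only [DiagRep.symbol, hp, slashM_mul]
    ring

lemma one_eq_U : (1 : Crossed) = U 1 1 := rfl

lemma XM_one : XM 1 = 0 := by
  have := XM_mul 1 1
  simpa using this

lemma YM_one : YM 1 = 0 := by
  have := YM_mul 1 1
  simpa using this

/-- The unit is U_1^*, so only the coefficients at γ = 1 matter; when they vanish, X, Y and δ₁ kill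
the unit and `H1` acts on it through the counit. -/
lemma rep_one (R : DiagRep) (hA : R.A 1 = 0) (hc : R.c = 0) (hp : R.p 1 = 0) (h : H1) :
    R.rep h 1 = algebraMap ℂ Crossed (H1.counitHom h) := by
  refine H1.gen_induction
    { carrier := {h | R.rep h 1 = algebraMap ℂ Crossed (H1.counitHom h)}
      mul_mem' := fun {h h'} ih ih' ↦ by
        rw [Set.mem_ofPred_eq] at *
        rw [map_mul, Module.End.mul_apply, ih', Algebra.algebraMap_eq_smul_one, map_smul, ih,
          map_mul H1.counitHom, mul_comm, map_mul, Algebra.smul_def]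
      add_mem' := fun {h h'} ih ih' ↦ by
        rw [Set.mem_ofPred_eq] at *
        simp only [map_add, LinearMap.add_apply, ih, ih']
      algebraMap_mem' := fun c ↦ by
        rw [Set.mem_ofPred_eq, AlgHom.commutes, AlgHom.commutes]
        simp [Algebra.algebraMap_eq_smul_one] } ?_ ?_ ?_ h
  · change R.rep H1.X 1 = _
    rw [one_eq_U, R.rep_X_U, XM_one, YM_one, hA]
    simp
  · change R.rep H1.Y 1 = _
    rw [one_eq_U, R.rep_Y_U, YM_one, hc]
    simp
  · change R.rep (H1.d 0) 1 = _
    rw [one_eq_U, R.rep_d_U, DiagRep.symbol, hp]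
    simp

lemma YM_incl_two (f : M 2) : YM (incl 2 f) = incl 2 f := by simp

/-- The standard action, as a diagonal representation. -/
def actionRep : DiagRep where
  A _ := 0
  m := 0
  c := 0
  p γ := incl 2 (mu γ)
  YM_A _ := map_zero _
  YM_m := map_zero _
  YM_p _ := YM_incl_two _

lemma actionRep_rep : actionRep.rep = action := by
  refine H1.algHom_ext ?_ ?_ ?_
  · rw [DiagRep.rep_X, action_X]
    refine crossed_ext fun γ f ↦ ?_
    simp [DiagRep.opX, opX, actionRep]
  · rw [DiagRep.rep_Y, action_Y]
    refine crossed_ext fun γ f ↦ ?_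
    simp [DiagRep.opY, opY, actionRep]
  · rw [DiagRep.rep_d, action_d]
    refine crossed_ext fun γ f ↦ ?_
    simp [DiagRep.opD, opD, actionRep, DiagRep.symbol, muIter]

lemma actionRep_orbit (a : Crossed) : actionRep.orbit a = orbit a := by
  rw [DiagRep.orbit, actionRep_rep]; rfl

/-! ### Construction of the cocycle, its inverse and the conjugate representation -/

section Cocycle

variable (t m : M 2) (c : ℂ)

/-- The representation `h ↦ ∑ u(h₁) h₂(·)`. -/
def twistRep : DiagRep where
  -- Read off from ∑ u(h₁) h₂(a): ΔX gives t a + X(a) + m Y(a), ΔY gives c a + Y(a), and Δδ₁ gives m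
  -- a + δ₁(a).
  A _ := incl 2 t
  m := incl 2 m
  c := c
  p γ := incl 2 m + incl 2 (mu γ)
  YM_A _ := YM_incl_two _
  YM_m := YM_incl_two _
  YM_p _ := by rw [map_add, YM_incl_two, YM_incl_two]

/-- The representation `h ↦ ∑ h₁(·) u⁻¹(h₂)`. -/
def cotwistRep : DiagRep where
  -- Solving u⁻¹u = ε on the generators gives u⁻¹(X) = c m - t, u⁻¹(Y) = -c and u⁻¹(δ₁) = -m.
  -- Multiplying U_γ^* on the right by a form produces its slash by γ, and δ₁ ⊗ Y contributes -c
  -- μ_γ.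
  A γ := slashM γ (incl 2 (c • m - t)) - c • incl 2 (mu γ)
  m := 0
  c := -c
  p γ := incl 2 (mu γ) - slashM γ (incl 2 m)
  YM_A γ := by rw [map_sub, map_smul, YM_slashM, YM_incl_two, YM_incl_two]
  YM_m := map_zero _
  YM_p γ := by rw [map_sub, YM_slashM, YM_incl_two, YM_incl_two]

/-- The conjugate representation `h ↦ ∑ u(h₁) h₂(·) u⁻¹(h₃)`. -/
def conjRep : DiagRep where
  -- These coefficients are forced by the identities of `leibniz` for the pair `twistRep`,
  -- `cotwistRep`. The differences f - f|γ are the symbols of inner derivations.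
  A γ := incl 2 (t - c • m) - slashM γ (incl 2 (t - c • m)) - c • incl 2 (mu γ)
  m := incl 2 m
  c := 0
  p γ := incl 2 (mu γ) + incl 2 m - slashM γ (incl 2 m)
  YM_A γ := by rw [map_sub, map_sub, map_smul, YM_slashM, YM_incl_two, YM_incl_two]
  YM_m := YM_incl_two _
  YM_p γ := by rw [map_sub, map_add, YM_slashM, YM_incl_two, YM_incl_two]

lemma twist_leibniz (h : H1) (a b : Crossed) :
    ((twistRep t m c).orbit a * orbit b) h = (twistRep t m c).rep h (a * b) := by
  rw [← actionRep_orbit]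
  refine leibniz _ _ _ (add_zero c).symm rfl (fun α β ↦ ?_) (fun α β ↦ ?_) (fun α ↦ ?_) h a b
  · simp [twistRep, actionRep]
  · simp only [twistRep, actionRep, incl_mu_mul]; abel
  · simp only [twistRep, actionRep, map_zero]; abel

lemma cotwist_leibniz (h : H1) (a b : Crossed) :
    ((cotwistRep t m c).orbit a * (twistRep t m c).orbit b) h = action h (a * b) := by
  rw [← actionRep_rep]
  refine leibniz actionRep (cotwistRep t m c) (twistRep t m c) (neg_add_cancel c).symm rfl
    (fun α β ↦ ?_) (fun α β ↦ ?_) (fun α ↦ ?_) h a b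
  · simp only [twistRep, actionRep, cotwistRep, map_sub, map_smul, smul_sub]; abel
  · simp only [twistRep, actionRep, cotwistRep, incl_mu_mul, map_add]; abel
  · simp only [twistRep, actionRep, cotwistRep]; abel

lemma conj_leibniz (h : H1) (a b : Crossed) :
    ((twistRep t m c).orbit a * (cotwistRep t m c).orbit b) h = (conjRep t m c).rep h (a * b) := by
  refine leibniz (conjRep t m c) (twistRep t m c) (cotwistRep t m c) (add_neg_cancel c).symm rfl
    (fun α β ↦ ?_) (fun α β ↦ ?_) (fun α ↦ ?_) h a b
  · simp only [twistRep, conjRep, cotwistRep, map_sub, map_smul, slashM_slashM, incl_mu_mul,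
      smul_add]
    module
  · simp only [twistRep, conjRep, cotwistRep, incl_mu_mul, map_sub, slashM_slashM]; abel
  · simp only [twistRep, conjRep, cotwistRep, map_zero]; abel

lemma action_one (h : H1) : action h 1 = algebraMap ℂ Crossed (H1.counitHom h) := by
  rw [← actionRep_rep]
  exact rep_one _ rfl rfl incl_mu_one h

lemma conjRep_one (h : H1) :
    (conjRep t m c).rep h 1 = algebraMap ℂ Crossed (H1.counitHom h) := by
  refine rep_one _ ?_ rfl ?_ h <;> simp [-slashM_incl, conjRep, slashM_one_left, incl_mu_one]

/-- The 1-cocycle with `u(X) = t`, `u(Y) = c`, `u(δ₁) = m`. -/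
def cocycle : Convˣ where
  val := (twistRep t m c).orbit 1
  inv := (cotwistRep t m c).orbit 1
  val_inv := WithConv.ext <| LinearMap.ext fun h ↦ by
    -- The product u u⁻¹ is the conjugate representation evaluated at 1 · 1, hence the counit; in
    -- the other order the original action plays this role.
    refine (conj_leibniz t m c h 1 1).trans ?_
    rw [mul_one, conjRep_one]
    rfl
  inv_val := WithConv.ext <| LinearMap.ext fun h ↦ by
    refine (cotwist_leibniz t m c h 1 1).trans ?_
    rw [mul_one, action_one]
    rfl

lemma cocycle_mul_orbit (a : Crossed) :
    (cocycle t m c : Conv) * orbit a = (twistRep t m c).orbit a :=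
  WithConv.ext <| LinearMap.ext fun h ↦ by
    refine (twist_leibniz t m c h 1 a).trans ?_
    rw [one_mul]
    rfl

lemma isOneCocycle_cocycle : IsOneCocycle (cocycle t m c) := by
  intro h h'
  rw [cocycle_mul_orbit]
  -- Once u * orbit is identified with `twistRep`, the cocycle identity is multiplicativity of a
  -- representation.
  change (twistRep t m c).rep (h * h') 1 = (twistRep t m c).rep h ((twistRep t m c).rep h' 1)
  rw [map_mul, Module.End.mul_apply]

lemma cocycle_X : (cocycle t m c : Conv) H1.X = ofForm (incl 2 t) := by
  change (twistRep t m c).rep H1.X 1 = _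
  rw [one_eq_U, DiagRep.rep_X_U, XM_one, YM_one, mul_zero, mul_one, zero_add, add_zero]
  rfl

lemma cocycle_Y : (cocycle t m c : Conv) H1.Y = algebraMap ℂ Crossed c := by
  change (twistRep t m c).rep H1.Y 1 = _
  rw [one_eq_U, DiagRep.rep_Y_U, YM_one, zero_add, map_smul, Algebra.algebraMap_eq_smul_one]
  rfl

lemma cocycle_d : (cocycle t m c : Conv) (H1.d 0) = ofForm (incl 2 m) := by
  change (twistRep t m c).rep (H1.d 0) 1 = _
  rw [one_eq_U, DiagRep.rep_d_U, DiagRep.symbol, mul_one]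
  simp [twistRep, incl_mu_one, ofForm]

lemma conjAction_cocycle (h : H1) (a : Crossed) :
    conjAction (cocycle t m c) h a = (conjRep t m c).rep h a := by
  rw [conjAction, cocycle_mul_orbit]
  refine (conj_leibniz t m c h a 1).trans ?_
  rw [mul_one]

end Cocycle

/-! Uniqueness. -/

lemma conv_mul_apply_X (u v : Conv) : (u * v) H1.X = u H1.X * v 1 + u 1 * v H1.X +
    u (H1.d 0) * v H1.Y := by
  change LinearMap.mul' ℂ Crossed (TensorProduct.map u.ofConv v.ofConv (H1.comulHom H1.X)) = _
  simp [H1.comulX]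

lemma conv_mul_apply_Y (u v : Conv) : (u * v) H1.Y = u H1.Y * v 1 + u 1 * v H1.Y := by
  change LinearMap.mul' ℂ Crossed (TensorProduct.map u.ofConv v.ofConv (H1.comulHom H1.Y)) = _
  simp [H1.comulY]

lemma conv_mul_apply_d (u v : Conv) :
    (u * v) (H1.d 0) = u (H1.d 0) * v 1 + u 1 * v (H1.d 0) := by
  change LinearMap.mul' ℂ Crossed (TensorProduct.map u.ofConv v.ofConv (H1.comulHom (H1.d 0))) = _
  simp [H1.comulD]

lemma conv_mul_apply_one (u v : Conv) : (u * v) 1 = u 1 * v 1 := by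
  change LinearMap.mul' ℂ Crossed (TensorProduct.map u.ofConv v.ofConv (H1.comulHom 1)) = _
  simp [Algebra.TensorProduct.one_def]

/-- The cocycle identity at (1, 1) makes u(1) idempotent, and convolution invertibility gives it a
right inverse. -/
lemma IsOneCocycle.apply_one {u : Convˣ} (hu : IsOneCocycle u) : (u : Conv) 1 = 1 := by
  have h1 := hu 1 1
  rw [conv_mul_apply_one, orbit_apply, mul_one, map_one action, Module.End.one_apply] at h1
  have h2 : (u : Conv) 1 * ((u⁻¹ : Convˣ) : Conv) 1 = 1 := by
    rw [← conv_mul_apply_one, Units.mul_inv]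
    change algebraMap ℂ Crossed (H1.counitHom 1) = 1
    rw [map_one, map_one]
  calc (u : Conv) 1 = (u : Conv) 1 * ((u : Conv) 1 * ((u⁻¹ : Convˣ) : Conv) 1) := by
        rw [h2, mul_one]
    _ = 1 := by rw [← mul_assoc, ← h1, h2]

/-- A 1-cocycle is determined by its values on the generators. -/
lemma IsOneCocycle.ext {u v : Convˣ} (hu : IsOneCocycle u) (hv : IsOneCocycle v)
    (hX : (u : Conv) H1.X = (v : Conv) H1.X) (hY : (u : Conv) H1.Y = (v : Conv) H1.Y)
    (hd : (u : Conv) (H1.d 0) = (v : Conv) (H1.d 0)) : u = v := by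
  have hu1 := hu.apply_one
  have hv1 := hv.apply_one
  -- The elements h for which left multiplication preserves agreement of u and v form a subalgebra.
  -- For a generator, u(hh') involves only u(h'), u(1) and the prescribed values.
  have key : ∀ h h' : H1, (u : Conv) h' = (v : Conv) h' →
      (u : Conv) (h * h') = (v : Conv) (h * h') := by
    intro h
    refine H1.gen_induction
      { carrier := {h | ∀ h' : H1, (u : Conv) h' = (v : Conv) h' →
          (u : Conv) (h * h') = (v : Conv) (h * h')}
        mul_mem' := fun {a b} ha hb h' e ↦ by
          rw [mul_assoc]
          exact ha _ (hb _ e)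
        add_mem' := fun {a b} ha hb h' e ↦ by
          rw [add_mul, map_add, map_add, ha _ e, hb _ e]
        algebraMap_mem' := fun c h' e ↦ by
          rw [← Algebra.smul_def, map_smul, map_smul, e] } ?_ ?_ ?_ h
    · intro h' e
      rw [hu, hv, conv_mul_apply_X, conv_mul_apply_X, hX, hd, hu1, hv1, e]
    · intro h' e
      rw [hu, hv, conv_mul_apply_Y, conv_mul_apply_Y, hY, hu1, hv1, e]
    · intro h' e
      rw [hu, hv, conv_mul_apply_d, conv_mul_apply_d, hd, hu1, hv1, e]
  refine Units.ext (WithConv.ext (LinearMap.ext fun h ↦ ?_))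
  have := key h 1 (hu1.trans hv1.symm)
  rwa [mul_one] at this

/-! The conjugate action. -/

/-- Moving f to the right past U_γ^* turns it into f|γ, so the commutator measures the failure of f
to be invariant under γ. -/
lemma ad_ofForm_U (f g : ModForms) (γ : GL(2, ℚ)⁺) :
    ad (ofForm f) (U γ g) = U γ ((f - slashM γ f) * g) := by
  rw [ad, ofForm, U_mul_U, U_mul_U, mul_one, one_mul, slashM_one_left, ← map_sub]
  congr 1
  ring

/-- The inner derivation, as a linear map. -/
def adLin (b : Crossed) : Module.End ℂ Crossed := LinearMap.mulLeft ℂ b - LinearMap.mulRight ℂ b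

lemma adLin_apply (b a : Crossed) : adLin b a = ad b a := rfl

section Conjugate

variable (t m : M 2) (c : ℂ) (a : Crossed)

lemma conjRep_Y : (conjRep t m c).rep H1.Y a = action H1.Y a := by
  have : (conjRep t m c).rep H1.Y = action H1.Y := crossed_ext fun γ f ↦ by
    rw [DiagRep.rep_Y_U, action_Y, opY, diagonal_U]
    simp [conjRep]
  rw [this]

lemma conjRep_X : (conjRep t m c).rep H1.X a = action H1.X a +
    ad (ofForm (incl 2 (t - c • m))) a - c • action (H1.d 0) a +
      ofForm (incl 2 m) * action H1.Y a := by
  have : (conjRep t m c).rep H1.X = action H1.X + adLin (ofForm (incl 2 (t - c • m))) -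
      c • action (H1.d 0) + LinearMap.mulLeft ℂ (ofForm (incl 2 m)) * action H1.Y :=
    crossed_ext fun γ f ↦ by
      simp only [LinearMap.add_apply, LinearMap.sub_apply, LinearMap.smul_apply,
        Module.End.mul_apply, LinearMap.mulLeft_apply, adLin_apply, ad_ofForm_U, DiagRep.rep_X_U,
        action_X, action_Y, action_d, opX, opY, opD, diagonal_U]
      rw [ofForm, U_mul_U, slashM_one_left, mul_one, ← map_smul, ← map_add, ← map_sub, ← map_add]
      congr 1
      simp only [conjRep, muIter, pow_zero, Module.End.one_apply, Algebra.smul_def]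
      ring
  rw [this]
  rfl

lemma conjRep_d : (conjRep t m c).rep (H1.d 0) a = action (H1.d 0) a +
    ad (ofForm (incl 2 m)) a := by
  have : (conjRep t m c).rep (H1.d 0) = action (H1.d 0) + adLin (ofForm (incl 2 m)) :=
    crossed_ext fun γ f ↦ by
      simp only [LinearMap.add_apply, adLin_apply, ad_ofForm_U, DiagRep.rep_d_U, DiagRep.symbol,
        action_d, opD, diagonal_U, LinearMap.mulLeft_apply, ← map_add]
      congr 1
      simp only [conjRep, muIter, pow_zero, Module.End.one_apply]
      ring
  rw [this]
  rfl

/-- Put n = m|γ and p = μ_γ + m - n. The symbol of the conjugate of δ₂' is X(p) + m p - p²/2. Since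
X(n) = X(m)|γ + μ_γ n, the mixed terms cancel, leaving X(μ_γ) - μ_γ²/2 plus the difference of X(m) +
m²/2 and its slash; `XM_mu` rewrites the first part. -/
lemma conjRep_schwarzian : (conjRep t m c).rep schwarzian a =
    ad (ofForm (XM (incl 2 m) + (1 / 2 : ℂ) • incl 2 m ^ 2 - incl 4 omegaFour)) a := by
  have : (conjRep t m c).rep schwarzian =
      adLin (ofForm (XM (incl 2 m) + (1 / 2 : ℂ) • incl 2 m ^ 2 - incl 4 omegaFour)) :=
    crossed_ext fun γ f ↦ by
      have h := XM_mu γ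
      -- After `Algebra.smul_def` the scalar 1/2 is an opaque element of the ring, and this relation
      -- is what lets the mixed terms cancel.
      have h2 : (2 : ModForms) * algebraMap ℂ ModForms (1 / 2) = 1 := by
        rw [← map_ofNat (algebraMap ℂ ModForms) 2, ← map_mul]
        norm_num
      rw [schwarzian, map_sub, map_smul, pow_two, map_mul, LinearMap.sub_apply,
        LinearMap.smul_apply, Module.End.mul_apply, DiagRep.rep_d_U, DiagRep.rep_d_U,
        DiagRep.rep_d_U, ← map_smul, ← map_sub, adLin_apply, ad_ofForm_U]
      congr 1
      simp only [DiagRep.symbol, conjRep, map_sub, map_add, map_smul, XM_slashM, YM_slashM,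
        YM_incl_two, pow_two, slashM_mul] at h ⊢
      simp only [Algebra.smul_def] at h ⊢
      set n := slashM γ (incl 2 m)
      linear_combination f * h - f * (incl 2 m ^ 2 + incl 2 m * incl 2 (mu γ) -
        incl 2 (mu γ) * n - incl 2 m * n) * h2
  rw [this]
  rfl

end Conjugate

/-! ### Nonvanishing of the conjugate Schwarzian -/

/-- Commuting with every U_γ^* means Ω|γ = Ω for all γ, which in weight 4 forces Ω = 0. -/
lemma ad_ofForm_ne_zero (Ω : M 4) (hΩ : Ω ≠ 0) :
    ¬ ∀ a : Crossed, ad (ofForm (incl 4 Ω)) a = 0 := by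
  intro h
  refine hΩ (Subtype.ext (eq_zero_of_slash_invariant (k := 4) four_ne_zero (IsModular.mdiff Ω.2)
    fun γ ↦ ?_))
  have h1 := h (U γ 1)
  rw [ad_ofForm_U, mul_one, slashM_incl, ← map_sub] at h1
  have h2 : incl 4 (Ω - slashLin 4 γ Ω) = 0 := by
    -- Summing all coefficients extracts the only one present, that of U_γ^*.
    have := congrArg (liftU fun γ' ↦ LinearMap.id) h1
    simpa using this
  have h3 := incl_injective 4 (h2.trans (map_zero _).symm)
  exact congrArg Subtype.val (sub_eq_zero.mp h3).symm

lemma ad_schwarzian_ne_zero (m : M 2) : ¬ ∀ a : Crossed,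
    ad (ofForm (XM (incl 2 m) + (1 / 2 : ℂ) • incl 2 m ^ 2 - incl 4 omegaFour)) a = 0 := by
  have e : XM (incl 2 m) + (1 / 2 : ℂ) • incl 2 m ^ 2 - incl 4 omegaFour =
      incl 4 (XTwo m + (1 / 2 : ℂ) • sqForm m - omegaFour) := by
    rw [incl_sq, XM_incl_two, map_sub, map_add, map_smul]
  rw [e]
  refine ad_ofForm_ne_zero _ fun h0 ↦ no_solution m ?_
  rw [← sub_eq_zero, e, h0, map_zero]

end ModularHecke

end

theorem mainTheorem5 :
    (∀ (t m : ModularHecke.M 2) (c : ℂ),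
      (∃! u : ModularHecke.Convˣ, ModularHecke.IsOneCocycle u ∧
        (u : ModularHecke.Conv) ModularHecke.H1.X =
          ModularHecke.ofForm (ModularHecke.incl 2 t) ∧
        (u : ModularHecke.Conv) ModularHecke.H1.Y = algebraMap ℂ ModularHecke.Crossed c ∧
        (u : ModularHecke.Conv) (ModularHecke.H1.d 0) =
          ModularHecke.ofForm (ModularHecke.incl 2 m)) ∧
      ∀ u : ModularHecke.Convˣ, ModularHecke.IsOneCocycle u →
        (u : ModularHecke.Conv) ModularHecke.H1.X =
          ModularHecke.ofForm (ModularHecke.incl 2 t) →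
        (u : ModularHecke.Conv) ModularHecke.H1.Y = algebraMap ℂ ModularHecke.Crossed c →
        (u : ModularHecke.Conv) (ModularHecke.H1.d 0) =
          ModularHecke.ofForm (ModularHecke.incl 2 m) →
        (∀ a : ModularHecke.Crossed,
          ModularHecke.conjAction u ModularHecke.H1.Y a =
            ModularHecke.action ModularHecke.H1.Y a) ∧
        (∀ a : ModularHecke.Crossed,
          ModularHecke.conjAction u ModularHecke.H1.X a =
            ModularHecke.action ModularHecke.H1.X a +
              ModularHecke.ad (ModularHecke.ofForm (ModularHecke.incl 2 (t - c • m))) a -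
              c • ModularHecke.action (ModularHecke.H1.d 0) a +
              ModularHecke.ofForm (ModularHecke.incl 2 m) *
                ModularHecke.action ModularHecke.H1.Y a) ∧
        (∀ a : ModularHecke.Crossed,
          ModularHecke.conjAction u (ModularHecke.H1.d 0) a =
            ModularHecke.action (ModularHecke.H1.d 0) a +
              ModularHecke.ad (ModularHecke.ofForm (ModularHecke.incl 2 m)) a) ∧
        (∀ a : ModularHecke.Crossed,
          ModularHecke.conjAction u ModularHecke.schwarzian a =
            ModularHecke.ad (ModularHecke.ofForm
              (ModularHecke.XM (ModularHecke.incl 2 m) +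
                (1 / 2 : ℂ) • ModularHecke.incl 2 m ^ 2 -
                ModularHecke.incl 4 ModularHecke.omegaFour)) a) ∧
        ¬ ∀ a : ModularHecke.Crossed,
          ModularHecke.conjAction u ModularHecke.schwarzian a = 0) ∧
    ∀ m : ModularHecke.M 2,
      ModularHecke.XM (ModularHecke.incl 2 m) + (1 / 2 : ℂ) • ModularHecke.incl 2 m ^ 2 ≠
        ModularHecke.incl 4 ModularHecke.omegaFour := by
  refine ⟨fun t m c ↦ ?_, ModularHecke.no_solution⟩
  have hu := ModularHecke.isOneCocycle_cocycle t m c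
  have hX := ModularHecke.cocycle_X t m c
  have hY := ModularHecke.cocycle_Y t m c
  have hd := ModularHecke.cocycle_d t m c
  refine ⟨⟨ModularHecke.cocycle t m c, ⟨hu, hX, hY, hd⟩, fun u ⟨h, h1, h2, h3⟩ ↦
    h.ext hu (h1.trans hX.symm) (h2.trans hY.symm) (h3.trans hd.symm)⟩, fun u h h1 h2 h3 ↦ ?_⟩
  -- Uniqueness replaces an arbitrary cocycle with these values by the constructed one, whose
  -- conjugate action is `conjRep`.
  rw [h.ext hu (h1.trans hX.symm) (h2.trans hY.symm) (h3.trans hd.symm)]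
  simp only [ModularHecke.conjAction_cocycle]
  refine ⟨ModularHecke.conjRep_Y t m c, ModularHecke.conjRep_X t m c, ModularHecke.conjRep_d t m c,
    ModularHecke.conjRep_schwarzian t m c, ?_⟩
  simp only [ModularHecke.conjRep_schwarzian]
  exact ModularHecke.ad_schwarzian_ne_zero m
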